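/- A (small) double category $\mathcal C$ consists of a category $\mathcal C_h$ of $h$-maps and a category $\mathcal C_v$ of $v$-maps with the same objects, together with a collection of squares, called bicommutative, whose horizontal sides are $h$-maps (drawn left to right) and whose vertical sides are $v$-maps (drawn top to bottom). For every $v$-map $\alpha$ the square with left and right sides $\alpha$ and identity horizontal sides is bicommutative, for every $h$-map $\beta$ the square with top and bottom sides $\beta$ and identity vertical sides is bicommutative, and bicommutative squares are closed under horizontal and under vertical pasting. A functor $I\to\mathcal C$ of double categories is a pair of functors $I_h\to\mathcal C_h$, $I_v\to\mathcal C_v$ that agree on objects and send bicommutative squares to bicommutative squares. The category $\mathrm{Map}(I,\mathcal C)_h$ has these functors as objects; a morphism $F_1\to F_2$ is a family of $h$-maps $F_1(X)\to F_2(X)$ that gives a commutative square for each $h$-map of $I$ and a bicommutative square for each $v$-map of $I$. Let $\Delta^n_v$ be the double category whose $v$-maps form the poset $0\to 1\to\cdots\to n$ and whose $h$-maps are identities. The nerve $N\mathcal C$ is the bisimplicial set for which $N\mathcal C_{*,q}$ is the nerve of the category $\mathrm{Map}(\Delta^q_v,\mathcal C)_h$. Its diagonal is the simplicial set $\operatorname{diag}(N\mathcal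 C)_n=N\mathcal C_{n,n}$. The natural map $N\mathcal C_h\to\operatorname{diag}(N\mathcal C)$ sends a chain of $n$ composable $h$-maps to the $n\times n$ array in which every row is that chain and every $v$-map is an identity. Let $Z$ be the double category generated by six objects and a single zig-zag of bicommutative squares $$\begin{array}{ccccc} 0&\xrightarrow{h}&1&\xleftarrow{h}&2\\ {\scriptstyle v}\downarrow&&{\scriptstyle v}\downarrow&&{\scriptstyle v}\downarrow\\ 3&\xrightarrow{h}&4&\xleftarrow{h}&5.\end{array}$$ **Proposition.** Let $\mathcal C$ be a double category. Suppose that every $v$-map $\alpha\colon X\to Y$ admits an $h$-functorial zig-zag of bicommutative squares of the form $$\begin{array}{ccccc} X&\xrightarrow{h}&\tilde X&\xleftarrow{h}&Y\\ {\scriptstyle\alpha}\downarrow&&{\scriptstyle v}\downarrow&&\downarrow{\scriptstyle\mathrm{Id}}\\ Y&\xrightarrow{\mathrm{Id}}&Y&\xleftarrow{\mathrm{Id}}&Y;\end{array}$$ that is, there is a functor $\Phi\colon\mathrm{Map}(\Delta^1_v,\mathcal C)_h\to\mathrm{Map}(Z,\mathcal C)_h$ whose restriction to the left column of $Z$ is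 the identity functor, whose restriction to the right column is $(\alpha\colon X\to Y)\mapsto \mathrm{Id}_Y$, and whose restriction to the bottom row is $(\alpha\colon X\to Y)\mapsto (Y=Y=Y)$ (as functors, on morphisms as well as on objects). Then the natural map $N\mathcal C_h\to\operatorname{diag}(N\mathcal C)$ is a weak equivalence of simplicial sets; that is, for every Kan complex $K$ it induces a bijection $[\operatorname{diag}(N\mathcal C),K]\to[N\mathcal C_h,K]$ on simplicial homotopy classes of maps. -/

import Mathlib

open CategoryTheory Simplicial Opposite

universe v u v₁ u₁ v₂ u₂

/-- A double category: a category of `h`-maps and a category of `v`-maps with the same objects,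
together with a collection of squares
```
  X --top--> Y
  |          |
 left      right
  |          |
  v          v
  X' --bot-> Y'
```
(horizontal arrows are `h`-maps and vertical arrows are `v`-maps), called *bicommutative*, which
contains the two kinds of identity squares and is closed under horizontal and vertical pasting. -/
structure DoubleCategory where
  /-- the objects -/
  Obj : Type u
  /-- the category of `h`-maps -/
  hCat : Category.{v} Obj
  /-- the category of `v`-maps -/
  vCat : Category.{v} Obj
  /-- `Sq top left right bot` says that the square with these four sides is bicommutative -/
  Sq : ∀ {X Y X' Y' : Obj}, hCat.Hom X Y → vCat.Hom X X' → vCat.Hom Y Y' → hCat.Hom X' Y' → Prop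
  sq_hId : ∀ {X X' : Obj} (a : vCat.Hom X X'), Sq (hCat.id X) a a (hCat.id X')
  sq_vId : ∀ {X Y : Obj} (b : hCat.Hom X Y), Sq b (vCat.id X) (vCat.id Y) b
  sq_hComp : ∀ {X Y Z X' Y' Z' : Obj} {f : hCat.Hom X Y} {g : hCat.Hom Y Z}
    {a : vCat.Hom X X'} {b : vCat.Hom Y Y'} {c : vCat.Hom Z Z'}
    {f' : hCat.Hom X' Y'} {g' : hCat.Hom Y' Z'},
    Sq f a b f' → Sq g b c g' → Sq (hCat.comp f g) a c (hCat.comp f' g')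
  sq_vComp : ∀ {X Y X' Y' X'' Y'' : Obj} {f : hCat.Hom X Y} {f' : hCat.Hom X' Y'}
    {f'' : hCat.Hom X'' Y''} {a : vCat.Hom X X'} {a' : vCat.Hom X' X''}
    {b : vCat.Hom Y Y'} {b' : vCat.Hom Y' Y''},
    Sq f a b f' → Sq f' a' b' f'' → Sq f (vCat.comp a a') (vCat.comp b b') f''

namespace DoubleCategory

/-- The category `C_h` of objects and `h`-maps of `C`. -/
def H (C : DoubleCategory.{v, u}) : Type u := C.Obj

/-- The category `C_v` of objects and `v`-maps of `C`. -/
def V (C : DoubleCategory.{v, u}) : Type u := C.Obj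

instance (C : DoubleCategory.{v, u}) : Category.{v} C.H := C.hCat

instance (C : DoubleCategory.{v, u}) : Category.{v} C.V := C.vCat

/-- Two preorders on the same set `T` give a double category, with at most one `h`-map and at most
one `v`-map from one object to another, and in which all squares are bicommutative. -/
def ofRel {T : Type u} (rh rv : T → T → Prop) (hrefl : ∀ x, rh x x)
    (htrans : ∀ x y z, rh x y → rh y z → rh x z) (vrefl : ∀ x, rv x x)
    (vtrans : ∀ x y z, rv x y → rv y z → rv x z) : DoubleCategory.{v, u} where
  Obj := T
  hCat :=
    { Hom := fun x y => ULift (PLift (rh x y))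
      id := fun x => ⟨⟨hrefl x⟩⟩
      comp := fun f g => ⟨⟨htrans _ _ _ f.down.down g.down.down⟩⟩ }
  vCat :=
    { Hom := fun x y => ULift (PLift (rv x y))
      id := fun x => ⟨⟨vrefl x⟩⟩
      comp := fun f g => ⟨⟨vtrans _ _ _ f.down.down g.down.down⟩⟩ }
  Sq := fun _ _ _ _ => True
  sq_hId := fun _ => trivial
  sq_vId := fun _ => trivial
  sq_hComp := fun _ _ => trivial
  sq_vComp := fun _ _ => trivial

/-- The double category `Δ^n_v`: the `v`-maps form the poset `0 → 1 → ⋯ → n`, and all `h`-maps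
are identities (so every square is an identity square, hence bicommutative). -/
def deltaV (n : ℕ) : DoubleCategory.{0, 0} :=
  ofRel (T := Fin (n + 1)) (fun i j => i = j) (fun i j => i ≤ j) (fun _ => rfl)
    (fun _ _ _ => Eq.trans) (fun _ => le_rfl) (fun _ _ _ => le_trans)

/-- The relation on `{0, 1, 2}` generated by `0 → 1 ← 2`. -/
def zigzagRel (i j : Fin 3) : Prop := i = j ∨ j = 1

theorem zigzagRel_trans (i j k : Fin 3) (h : zigzagRel i j) (h' : zigzagRel j k) :
    zigzagRel i k := by
  unfold zigzagRel at *
  omega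

/-- The double category consisting of three objects and the zig-zag `0 → 1 ← 2` of `h`-maps,
all `v`-maps being identities. -/
def zigzagH : DoubleCategory.{0, 0} :=
  ofRel (T := Fin 3) zigzagRel (fun i j => i = j) (fun _ => Or.inl rfl) zigzagRel_trans
    (fun _ => rfl) (fun _ _ _ => Eq.trans)

/-- The double category `Z` consisting of six objects and a single zig-zag of bicommutative squares
```
 (0,0) --h--> (1,0) <--h-- (2,0)
   |            |            |
   v            v            v
 (0,1) --h--> (1,1) <--h-- (2,1)
```
in which the first coordinate is the column and the second one the row. -/
def zigzagSquares : DoubleCategory.{0, 0} :=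
  ofRel (T := Fin 3 × Fin 2) (fun x y => zigzagRel x.1 y.1 ∧ x.2 = y.2)
    (fun x y => x.1 = y.1 ∧ x.2 ≤ y.2) (fun _ => ⟨Or.inl rfl, rfl⟩)
    (fun _ _ _ h h' => ⟨zigzagRel_trans _ _ _ h.1 h'.1, h.2.trans h'.2⟩) (fun _ => ⟨rfl, le_rfl⟩)
    (fun _ _ _ h h' => ⟨h.1.trans h'.1, h.2.trans h'.2⟩)

/-- A functor `I → C` of double categories: a functor on `h`-maps and a functor on `v`-maps which
have the same behaviour on objects and send bicommutative squares to bicommutative squares. -/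
structure DFunctor (I : DoubleCategory.{v₁, u₁}) (C : DoubleCategory.{v, u}) where
  obj : I.Obj → C.Obj
  hmap : ∀ {X Y : I.Obj}, I.hCat.Hom X Y → C.hCat.Hom (obj X) (obj Y)
  vmap : ∀ {X Y : I.Obj}, I.vCat.Hom X Y → C.vCat.Hom (obj X) (obj Y)
  hmap_id : ∀ X : I.Obj, hmap (I.hCat.id X) = C.hCat.id (obj X)
  hmap_comp : ∀ {X Y Z : I.Obj} (f : I.hCat.Hom X Y) (g : I.hCat.Hom Y Z),
    hmap (I.hCat.comp f g) = C.hCat.comp (hmap f) (hmap g)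
  vmap_id : ∀ X : I.Obj, vmap (I.vCat.id X) = C.vCat.id (obj X)
  vmap_comp : ∀ {X Y Z : I.Obj} (f : I.vCat.Hom X Y) (g : I.vCat.Hom Y Z),
    vmap (I.vCat.comp f g) = C.vCat.comp (vmap f) (vmap g)
  map_sq : ∀ {X Y X' Y' : I.Obj} {f : I.hCat.Hom X Y} {a : I.vCat.Hom X X'} {b : I.vCat.Hom Y Y'}
    {f' : I.hCat.Hom X' Y'}, I.Sq f a b f' → C.Sq (hmap f) (vmap a) (vmap b) (hmap f')

section Map

variable {I : DoubleCategory.{v₁, u₁}} {C : DoubleCategory.{v, u}}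

/-- An `h`-map of `Map(I, C)`: a family of `h`-maps of `C` giving commutative squares on the
`h`-maps of `I` and bicommutative squares on the `v`-maps of `I`. -/
@[ext]
structure HTrans (F G : DFunctor I C) where
  app : ∀ X : I.Obj, C.hCat.Hom (F.obj X) (G.obj X)
  naturality : ∀ {X Y : I.Obj} (f : I.hCat.Hom X Y),
    C.hCat.comp (F.hmap f) (app Y) = C.hCat.comp (app X) (G.hmap f)
  sq : ∀ {X Y : I.Obj} (a : I.vCat.Hom X Y), C.Sq (app X) (F.vmap a) (G.vmap a) (app Y)

/-- A `v`-map of `Map(I, C)`: a family of `v`-maps of `C` giving commutative squares on the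
`v`-maps of `I` and bicommutative squares on the `h`-maps of `I`. -/
@[ext]
structure VTrans (F G : DFunctor I C) where
  app : ∀ X : I.Obj, C.vCat.Hom (F.obj X) (G.obj X)
  naturality : ∀ {X Y : I.Obj} (a : I.vCat.Hom X Y),
    C.vCat.comp (F.vmap a) (app Y) = C.vCat.comp (app X) (G.vmap a)
  sq : ∀ {X Y : I.Obj} (f : I.hCat.Hom X Y), C.Sq (F.hmap f) (app X) (app Y) (G.hmap f)

/-- Identity `h`-map of `Map(I, C)`. -/
def HTrans.id (F : DFunctor I C) : HTrans F F where
  app X := C.hCat.id (F.obj X)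
  naturality _ := (C.hCat.comp_id _).trans (C.hCat.id_comp _).symm
  sq _ := C.sq_hId _

/-- Composition of `h`-maps of `Map(I, C)`. -/
def HTrans.comp {F G K : DFunctor I C} (s : HTrans F G) (t : HTrans G K) : HTrans F K where
  app X := C.hCat.comp (s.app X) (t.app X)
  naturality f := by
    rw [← C.hCat.assoc, s.naturality, C.hCat.assoc, t.naturality, C.hCat.assoc]
  sq a := C.sq_hComp (s.sq a) (t.sq a)

/-- Identity `v`-map of `Map(I, C)`. -/
def VTrans.id (F : DFunctor I C) : VTrans F F where
  app X := C.vCat.id (F.obj X)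
  naturality _ := (C.vCat.comp_id _).trans (C.vCat.id_comp _).symm
  sq _ := C.sq_vId _

/-- Composition of `v`-maps of `Map(I, C)`. -/
def VTrans.comp {F G K : DFunctor I C} (s : VTrans F G) (t : VTrans G K) : VTrans F K where
  app X := C.vCat.comp (s.app X) (t.app X)
  naturality f := by
    rw [← C.vCat.assoc, s.naturality, C.vCat.assoc, t.naturality, C.vCat.assoc]
  sq a := C.sq_vComp (s.sq a) (t.sq a)

end Map

/-- The double category `Map(I, C)` of functors `I → C`; a square in it is bicommutative when it
is so at every object of `I`. -/
def Map (I : DoubleCategory.{v₁, u₁}) (C : DoubleCategory.{v, u}) :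
    DoubleCategory.{max u₁ v, max u₁ v₁ u v} where
  Obj := DFunctor I C
  hCat :=
    { Hom := HTrans
      id := HTrans.id
      comp := HTrans.comp
      id_comp := fun _ => HTrans.ext (funext fun _ => C.hCat.id_comp _)
      comp_id := fun _ => HTrans.ext (funext fun _ => C.hCat.comp_id _)
      assoc := fun _ _ _ => HTrans.ext (funext fun _ => C.hCat.assoc _ _ _) }
  vCat :=
    { Hom := VTrans
      id := VTrans.id
      comp := VTrans.comp
      id_comp := fun _ => VTrans.ext (funext fun _ => C.vCat.id_comp _)
      comp_id := fun _ => VTrans.ext (funext fun _ => C.vCat.comp_id _)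
      assoc := fun _ _ _ => VTrans.ext (funext fun _ => C.vCat.assoc _ _ _) }
  Sq := fun f a b f' => ∀ X : I.Obj, C.Sq (f.app X) (a.app X) (b.app X) (f'.app X)
  sq_hId := fun _ _ => C.sq_hId _
  sq_vId := fun _ _ => C.sq_vId _
  sq_hComp := fun h h' X => C.sq_hComp (h X) (h' X)
  sq_vComp := fun h h' X => C.sq_vComp (h X) (h' X)

/-- Composition of functors of double categories. -/
def DFunctor.comp {I : DoubleCategory.{v₁, u₁}} {J : DoubleCategory.{v₂, u₂}}
    {C : DoubleCategory.{v, u}} (P : DFunctor I J) (F : DFunctor J C) : DFunctor I C where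
  obj X := F.obj (P.obj X)
  hmap f := F.hmap (P.hmap f)
  vmap a := F.vmap (P.vmap a)
  hmap_id X := by rw [P.hmap_id, F.hmap_id]
  hmap_comp f g := by rw [P.hmap_comp, F.hmap_comp]
  vmap_id X := by rw [P.vmap_id, F.vmap_id]
  vmap_comp f g := by rw [P.vmap_comp, F.vmap_comp]
  map_sq h := F.map_sq (P.map_sq h)

/-- Restriction along `P : I → J`, as a functor `Map(J, C)_h ⥤ Map(I, C)_h`. -/
def restrictH {I : DoubleCategory.{v₁, u₁}} {J : DoubleCategory.{v₂, u₂}}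
    (P : DFunctor I J) (C : DoubleCategory.{v, u}) : (Map J C).H ⥤ (Map I C).H where
  obj F := DFunctor.comp P F
  map {F G} (s : HTrans F G) :=
    { app := fun X => s.app (P.obj X)
      naturality := fun f => s.naturality (P.hmap f)
      sq := fun a => s.sq (P.vmap a) : HTrans (DFunctor.comp P F) (DFunctor.comp P G) }

/-- Evaluation at an object `i` of `I`, as a functor `Map(I, C)_h ⥤ C_h`. -/
def evalH {I : DoubleCategory.{v₁, u₁}} (i : I.Obj) (C : DoubleCategory.{v, u}) :
    (Map I C).H ⥤ C.H where
  obj F := DFunctor.obj F i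
  map {F G} (s : HTrans F G) := s.app i

/-- The constant functor `I → C` with value `X`: it sends all `h`-maps and all `v`-maps to
identities. -/
def constObj (I : DoubleCategory.{v₁, u₁}) {C : DoubleCategory.{v, u}} (X : C.Obj) :
    DFunctor I C where
  obj _ := X
  hmap _ := C.hCat.id X
  vmap _ := C.vCat.id X
  hmap_id _ := rfl
  hmap_comp _ _ := (C.hCat.id_comp _).symm
  vmap_id _ := rfl
  vmap_comp _ _ := (C.vCat.id_comp _).symm
  map_sq _ := C.sq_hId _

/-- Constant functors, as a functor `C_h ⥤ Map(I, C)_h`. -/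
def constH (I : DoubleCategory.{v₁, u₁}) (C : DoubleCategory.{v, u}) : C.H ⥤ (Map I C).H where
  obj X := constObj I X
  map {X Y} f :=
    { app := fun _ => f
      naturality := fun _ => (C.hCat.id_comp _).trans (C.hCat.comp_id _).symm
      sq := fun _ => C.sq_vId f : HTrans (constObj I X) (constObj I Y) }

/-- The inclusion `Δ^1_v → Z` of the column `i` of `Z`. -/
def column (i : Fin 3) : DFunctor (deltaV 1) zigzagSquares where
  obj j := (i, j)
  hmap f := ⟨⟨Or.inl rfl, f.down.down⟩⟩
  vmap a := ⟨⟨rfl, a.down.down⟩⟩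
  hmap_id _ := rfl
  hmap_comp _ _ := rfl
  vmap_id _ := rfl
  vmap_comp _ _ := rfl
  map_sq _ := trivial

/-- The inclusion into `Z` of its bottom row. -/
def bottomRow : DFunctor zigzagH zigzagSquares where
  obj i := (i, 1)
  hmap f := ⟨⟨f.down.down, rfl⟩⟩
  vmap a := ⟨⟨a.down.down, le_rfl⟩⟩
  hmap_id _ := rfl
  hmap_comp _ _ := rfl
  vmap_id _ := rfl
  vmap_comp _ _ := rfl
  map_sq _ := trivial

/-- The functor `Map(Δ^1_v, C)_h ⥤ C_h` sending a `v`-map `X → Y` to its target `Y`. -/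
def targetH (C : DoubleCategory.{v, u}) : (Map (deltaV 1) C).H ⥤ C.H :=
  evalH (I := deltaV 1) (1 : Fin 2) C

/-- A functor `Φ : Map(Δ^1_v, C)_h ⥤ Map(Z, C)_h` is an `h`-functorial zig-zag of the form
```
  X --h--> X̃ <--h-- Y
  |        |        |
  α        |       Id
  v        v        v
  Y --Id-> Y <-Id-- Y
```
(for each `v`-map `α : X → Y`, functorially with respect to the `h`-maps of `Map(Δ^1_v, C)`) if
its left column is `α`, its right column is `Id_Y` and its bottom row is `Y = Y = Y`. -/
structure IsReductionZigZag (C : DoubleCategory.{v, u})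
    (Φ : (Map (deltaV 1) C).H ⥤ (Map zigzagSquares C).H) : Prop where
  left_column : Φ ⋙ restrictH (column 0) C = 𝟭 (Map (deltaV 1) C).H
  right_column : Φ ⋙ restrictH (column 2) C = targetH C ⋙ constH (deltaV 1) C
  bottom_row : Φ ⋙ restrictH bottomRow C = targetH C ⋙ constH zigzagH C

/-- The functor `Δ^m_v → Δ^n_v` given by a monotone map `[m] → [n]`. -/
def deltaVMap {m n : SimplexCategory} (f : m ⟶ n) : DFunctor (deltaV m.len) (deltaV n.len) where
  obj i := f.toOrderHom i
  hmap e := ⟨⟨congrArg f.toOrderHom e.down.down⟩⟩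
  vmap a := ⟨⟨f.toOrderHom.monotone a.down.down⟩⟩
  hmap_id _ := rfl
  hmap_comp _ _ := rfl
  vmap_id _ := rfl
  vmap_comp _ _ := rfl
  map_sq _ := trivial

/-- The nerve of `C`, a bisimplicial set, given as the simplicial object `q ↦ N C_{*,q}` in
simplicial sets, where `N C_{*,q}` is the usual nerve of the category `Map(Δ^q_v, C)_h`. -/
def bisimplicialNerve (C : DoubleCategory.{v, u}) : SimplicialObject SSet.{max u v} where
  obj q := nerve (Map (deltaV q.unop.len) C).H
  map f := nerveMap (restrictH (deltaVMap f.unop) C)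

end DoubleCategory

/-- The diagonal `n ↦ B_{n,n}` of a bisimplicial set. -/
def SSet.diag (B : SimplicialObject SSet.{u}) : SSet.{u} where
  obj n := (B.obj n).obj n
  map {m n} f := (B.map f).app m ≫ (B.obj n).map f
  map_comp {l m n} f g := by
    rw [B.map_comp, (B.obj n).map_comp, SSet.comp_app, Category.assoc, Category.assoc,
      (B.map g).naturality_assoc]

/-- The natural map `N C_h ⟶ diag (N C)`, sending a chain of `n` composable `h`-maps to
the `n × n` array all of whose rows are that chain and all of whose `v`-maps are identities. -/
def DoubleCategory.nerveToDiag (C : DoubleCategory.{v, u}) :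
    nerve C.H ⟶ SSet.diag C.bisimplicialNerve where
  app n := ↾fun (x : ComposableArrows C.H n.unop.len) =>
    ((constH (deltaV n.unop.len) C).mapComposableArrows n.unop.len).obj x
  naturality _ _ _ := rfl

/-- Precomposition with `f : X ⟶ Y` on simplicial homotopy classes of maps to `K`, i.e. on the
quotients of the sets of maps by the equivalence relation generated by simplicial homotopy. -/
def SSet.precompHomotopyClasses {X Y : SSet.{u}} (f : X ⟶ Y) (K : SSet.{u}) :
    Quot (fun a b : Y ⟶ K => Nonempty (SSet.Homotopy a b)) →
      Quot (fun a b : X ⟶ K => Nonempty (SSet.Homotopy a b)) :=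
  Quot.map (fun a => f ≫ a) (fun _ _ ⟨h⟩ =>
    ⟨RelativeMorphism.Homotopy.precomp h (RelativeMorphism.botEquiv.symm f)
      (Subcomplex.isInitialBot.hom_ext _ _)⟩)

/-- A map `f : X ⟶ Y` of simplicial sets is a weak equivalence if it induces a bijection
`[Y, K] → [X, K]` on simplicial homotopy classes of maps for every Kan complex `K`. -/
def SSet.IsWeakEquivalence {X Y : SSet.{u}} (f : X ⟶ Y) : Prop :=
  ∀ (K : SSet.{u}) [SSet.KanComplex K], Function.Bijective (SSet.precompHomotopyClasses f K)

-- Write `B_q` for the simplicial set `N C_{*,q}`, whose vertices are the chains of `q` composable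
-- `v`-maps. The images of `B_q × Δ[q]` filter the diagonal, from the image of `N C_h` (at `q = 0`)
-- up to everything. Stage `q + 1` is a pushout of stage `q` along the pushout-product of the
-- latching inclusion `L ⊆ B_{q+1}`, where `L` is the union of the images of the `σ i`, with
-- `∂Δ[q+1] ⊆ Δ[q+1]`. So it suffices that the latching inclusions are acyclic.
--
-- Acyclicity (`IsAcyclicPair`) means extension of maps to Kan complexes after pushout-product with
-- any inclusion. In this form it is formally stable under pushout-products, cobase change and
-- sequential unions. The inclusions `∅ ⊆ Δ[0]` and `∂Δ[1] ⊆ Δ[1]` then give the bijection on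
-- homotopy classes.
--
-- The columns of `Φ` give homotopies on `B_1` from the identity and from `σ₀ ∘ δ₀` (that is, `α ↦
-- Id_Y`) to a common map, the middle column; the bottom row makes them constant on targets. A chain
-- of `q + 1` `v`-maps is its first `v`-map followed by a chain starting at the target of that map,
-- so both homotopies extend to `B_{q+1}` by changing the first `v`-map only. They connect the
-- identity to the idempotent `σ₀ ∘ δ₀`, with image `D = range σ₀`, and preserve the union `E` of
-- the images of the `σ i` with `i ≥ 1`. Hence `D ⊆ B_{q+1}` and `D ∩ E ⊆ E` are acyclic
-- (`of_zigzag`); `excision` gives `D ⊆ D ∪ E = L`, and the cancellation `of_le_of_le` gives `L ⊆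
-- B_{q+1}`. The homotopies may move points of `D`; `of_zigzag` corrects this inside the Kan
-- complex.

universe w v' u'

section

open MonoidalCategory

/-! ### Partial maps to Kan complexes and homotopy extension. -/

namespace SSet

variable {X X' Y K : SSet.{w}}

/-- A family of functions on the simplices of `X` is a map on the subcomplex `U` if it commutes
with the simplicial operators on the simplices of `U`; its values elsewhere are irrelevant. -/
def IsMapOn (U : X.Subcomplex) (f : ∀ n, X.obj n → K.obj n) : Prop :=
  ∀ ⦃n m : SimplexCategoryᵒᵖ⦄ (g : n ⟶ m) (x : X.obj n), x ∈ U.obj n →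
    f m (X.map g x) = K.map g (f n x)

namespace IsMapOn

variable {U V : X.Subcomplex} {f f' : ∀ n, X.obj n → K.obj n}

lemma mono (hf : IsMapOn V f) (h : U ≤ V) : IsMapOn U f :=
  fun _ _ g x hx => hf g x (h _ hx)

/-- The condition concerns one simplex at a time and `f` is a single family, so there is no
agreement on `U ⊓ V` to check. -/
lemma sup (hU : IsMapOn U f) (hV : IsMapOn V f) : IsMapOn (U ⊔ V) f :=
  fun _ _ g x hx => hx.elim (hU g x) (hV g x)

lemma congr (hf : IsMapOn U f) (h : ∀ n (x : X.obj n), x ∈ U.obj n → f' n x = f n x) :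
    IsMapOn U f' := fun _ _ g x hx => by
  rw [h _ _ hx, h _ _ (U.map g hx), hf g x hx]

lemma comp (hf : IsMapOn V f) (φ : X' ⟶ X) {U' : X'.Subcomplex}
    (h : ∀ n (x : X'.obj n), x ∈ U'.obj n → φ.app n x ∈ V.obj n) :
    IsMapOn U' (fun n x => f n (φ.app n x)) := fun _ _ g x hx => by
  dsimp only
  rw [NatTrans.naturality_apply]
  exact hf g _ (h _ _ hx)

lemma of_hom (φ : X ⟶ K) (U : X.Subcomplex) : IsMapOn U (fun n x => φ.app n x) :=
  fun _ _ g x _ => NatTrans.naturality_apply φ g x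

/-- The map of simplicial sets given by a family which is a map everywhere. -/
def hom (hf : IsMapOn ⊤ f) : X ⟶ K where
  app n := ↾(f n)
  naturality _ _ g := by
    ext x
    exact hf g x trivial

/-- The map of simplicial sets given by a family which is a map on `U`. -/
def homOn (hf : IsMapOn U f) : (U : SSet.{w}) ⟶ K where
  app n := ↾(fun x => f n x.1)
  naturality _ _ g := by
    ext x
    exact hf g x.1 x.2

end IsMapOn

/-- The vertex `e` of `Δ[1]`, as a subcomplex. -/
def endpoint (e : Fin 2) : (Δ[1] : SSet.{w}).Subcomplex where
  obj n := {t | t = stdSimplex.const 1 e n}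
  map g t ht := by
    obtain rfl : t = _ := ht
    rfl

lemma mem_endpoint_iff {e : Fin 2} {n : SimplexCategoryᵒᵖ} {t : (Δ[1] : SSet.{w}).obj n} :
    t ∈ (endpoint e).obj n ↔ t = stdSimplex.const 1 e n := Iff.rfl

lemma const_ne {n : SimplexCategoryᵒᵖ} :
    (stdSimplex.const 1 1 n : (Δ[1] : SSet.{w}).obj n) ≠ stdSimplex.const 1 0 n := fun h => by
  have := congrArg (fun t => stdSimplex.asOrderHom t 0) h
  exact absurd this (by change ¬ ((1 : Fin 2) = 0); decide)

/-- This makes the inclusion of either end of `Δ[1]` anodyne. -/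
lemma horn_one_eq_endpoint (e : Fin 2) : (Λ[1, e] : (Δ[1] : SSet.{w}).Subcomplex) = endpoint e := by
  ext n t
  rw [mem_horn_iff, mem_endpoint_iff]
  constructor
  · intro h
    apply stdSimplex.objEquiv.injective
    ext i : 3
    change stdSimplex.asOrderHom t i = e
    by_contra hi
    refine h (Set.eq_univ_of_forall fun j => ?_)
    by_cases hj : j = e
    · exact Or.inr hj
    · refine Or.inl ⟨i, ?_⟩
      generalize stdSimplex.asOrderHom t i = k at *
      change k ≠ e at hi
      change Fin 2 at j k
      omega
  · rintro rfl h
    have : (1 - e : Fin 2) ∈ (Set.univ : Set (Fin 2)) := trivial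
    rw [← h] at this
    rcases this with ⟨i, hi⟩ | hi
    · change e = 1 - e at hi
      revert hi; clear h; revert e; decide
    · change 1 - e = e at hi
      revert hi; clear h; revert e; decide

lemma anodyneExtensions_endpoint_ι (e : Fin 2) : anodyneExtensions (endpoint.{w} e).ι := by
  rw [← horn_one_eq_endpoint]
  exact anodyneExtensions.horn_ι e

open modelCategoryQuillen in
lemma IsMapOn.exists_hom_of_anodyneExtensions [KanComplex K] {U : X.Subcomplex}
    {f : ∀ n, X.obj n → K.obj n} (hf : IsMapOn U f) (hU : anodyneExtensions U.ι) :
    ∃ F : X ⟶ K, ∀ n (x : X.obj n), x ∈ U.obj n → F.app n x = f n x := by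
  have sq : CommSq hf.homOn U.ι (Limits.terminal.from K) (Limits.terminal.from X) := ⟨by simp⟩
  have : HasLiftingProperty U.ι (Limits.terminal.from K) :=
    hU _ ((HomotopicalAlgebra.fibration_iff _).1 inferInstance)
  refine ⟨sq.lift, fun n x hx => ?_⟩
  exact ConcreteCategory.congr_hom (NatTrans.congr_app sq.fac_left n) ⟨x, hx⟩

/-- Maps from `V × {e} ∪ U × Δ[1]` to a Kan complex extend to `V × Δ[1]`. -/
lemma IsMapOn.exists_cylinder [KanComplex K] {U V : X.Subcomplex} (e : Fin 2)
    {f : ∀ n, (X ⊗ Δ[1] : SSet.{w}).obj n → K.obj n}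
    (hf : IsMapOn (V.prod (endpoint e) ⊔ U.prod ⊤) f) :
    ∃ F : ∀ n, (X ⊗ Δ[1] : SSet.{w}).obj n → K.obj n, IsMapOn (V.prod ⊤) F ∧
      ∀ n (x : X.obj n) (t : (Δ[1] : SSet.{w}).obj n), x ∈ V.obj n →
        (t = stdSimplex.const 1 e n ∨ x ∈ U.obj n) → F n (x, t) = f n (x, t) := by
  classical
  -- Inside `V × Δ[1]` the domain becomes a union product with an end of `Δ[1]`, so its inclusion is
  -- anodyne.
  have h₁ : IsMapOn ((U.preimage V.ι).unionProd (endpoint e))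
      (fun n z => f n ((V.ι ▷ Δ[1]).app n z)) := by
    refine hf.comp (V.ι ▷ Δ[1]) ?_
    rintro n ⟨x, t⟩ (⟨-, ht⟩ | ⟨hx, -⟩)
    · exact Or.inl ⟨x.2, ht⟩
    · exact Or.inr ⟨hx, trivial⟩
  obtain ⟨F, hF⟩ := h₁.exists_hom_of_anodyneExtensions
    (anodyneExtensions_unionProd_ι _ _ (anodyneExtensions_endpoint_ι e))
  refine ⟨fun n z => if h : z.1 ∈ V.obj n then F.app n ((⟨z.1, h⟩ : V.obj n), z.2) else f n z,
    ?_, ?_⟩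
  · rintro n m g ⟨x, t⟩ ⟨hx, -⟩
    have hx' : X.map g x ∈ V.obj m := V.map g hx
    refine (dif_pos hx').trans (Eq.trans ?_ (congrArg _ (dif_pos hx).symm))
    exact NatTrans.naturality_apply F g ((⟨x, hx⟩, t) : ((V : SSet.{w}) ⊗ Δ[1]).obj n)
  · intro n x t hx h
    refine (dif_pos hx).trans ?_
    refine hF n ((⟨x, hx⟩ : V.obj n), t) ?_
    rcases h with h | h
    · exact Or.inl ⟨trivial, h⟩
    · exact Or.inr ⟨h, trivial⟩

/-! ### Acyclic pairs: excision, cancellation and zig-zags of homotopies. -/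

/-- For subcomplexes `A ≤ B`, the condition that `A ⟶ B` has, after taking the pushout-product with
any inclusion `S ⟶ Y`, the left lifting property with respect to all Kan complexes: maps from
`A × Y ∪ B × S` to a Kan complex extend to `B × Y`. -/
def IsAcyclicPair (A B : X.Subcomplex) : Prop :=
  ∀ (K : SSet.{w}) [KanComplex K] (Y : SSet.{w}) (S : Y.Subcomplex)
    (f : ∀ n, (X ⊗ Y).obj n → K.obj n), IsMapOn (A.prod ⊤ ⊔ B.prod S) f →
    ∃ F : ∀ n, (X ⊗ Y).obj n → K.obj n, IsMapOn (B.prod ⊤) F ∧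
      ∀ n (x : X.obj n) (y : Y.obj n), (x ∈ A.obj n ∨ x ∈ B.obj n ∧ y ∈ S.obj n) →
        F n (x, y) = f n (x, y)

namespace IsAcyclicPair

/-- Extend over `E × Y` relative to `(D ∩ E) × Y ∪ E × S`, then glue with the given map on `D × Y`.
-/
lemma excision {D E : X.Subcomplex} (h : IsAcyclicPair (D ⊓ E) E) : IsAcyclicPair D (D ⊔ E) := by
  classical
  intro K _ Y S f hf
  obtain ⟨F, hF, hFf⟩ := h K Y S f (hf.mono (by
    rintro n ⟨x, y⟩ (⟨hx, -⟩ | ⟨hx, hy⟩)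
    · exact Or.inl ⟨hx.1, trivial⟩
    · exact Or.inr ⟨Or.inr hx, hy⟩))
  have key : ∀ n (x : X.obj n) (y : Y.obj n), x ∈ E.obj n → (x ∈ D.obj n ∨ y ∈ S.obj n) →
      F n (x, y) = f n (x, y) := fun n x y hx h => by
    rcases h with h | h
    · exact hFf n x y (Or.inl ⟨h, hx⟩)
    · exact hFf n x y (Or.inr ⟨hx, h⟩)
  refine ⟨fun n z => if z.1 ∈ D.obj n then f n z else F n z, ?_, ?_⟩
  · have h₁ : IsMapOn (D.prod (⊤ : Y.Subcomplex))
        (fun n z => if z.1 ∈ D.obj n then f n z else F n z) :=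
      (hf.mono le_sup_left).congr fun n z hz => if_pos hz.1
    have h₂ : IsMapOn (E.prod (⊤ : Y.Subcomplex))
        (fun n z => if z.1 ∈ D.obj n then f n z else F n z) := by
      refine hF.congr ?_
      rintro n ⟨x, y⟩ ⟨hx, -⟩
      dsimp only
      split_ifs with hD
      · exact (key n x y hx (Or.inl hD)).symm
      · rfl
    refine (h₁.sup h₂).mono ?_
    rintro n ⟨x, y⟩ ⟨hx | hx, -⟩
    · exact Or.inl ⟨hx, trivial⟩
    · exact Or.inr ⟨hx, trivial⟩
  · intro n x y h
    dsimp only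
    split_ifs with hD
    · rfl
    · rcases h with h | ⟨h, hy⟩
      · exact absurd h hD
      · exact key n x y (h.resolve_left hD) (Or.inr hy)

/-- Forgetting `f` on `L` outside `A`, one extends it to `F` on `B × Y`. On `L × Y` the maps `F` and
`f` agree over `A × Y ∪ L × S`, hence are homotopic relative to it, by acyclicity of `A ≤ L` tested
on `Y × Δ[1]`. Homotopy extension then deforms `F` to an extension of `f`. -/
lemma of_le_of_le {A L B : X.Subcomplex} (hAL : A ≤ L) (hLB : L ≤ B) (h₁ : IsAcyclicPair A L)
    (h₂ : IsAcyclicPair A B) : IsAcyclicPair L B := by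
  classical
  intro K _ Y S f hf
  obtain ⟨F, hF, hFf⟩ := h₂ K Y S f (hf.mono (by
    rintro n ⟨x, y⟩ (⟨hx, -⟩ | ⟨hx, hy⟩)
    · exact Or.inl ⟨hAL _ hx, trivial⟩
    · exact Or.inr ⟨hx, hy⟩))
  -- a homotopy on `L × Y`, relative to `A × Y ∪ L × S`, from `F` to `f`
  let c : ∀ n, (X ⊗ (Y ⊗ Δ[1])).obj n → K.obj n := fun n z =>
    if z.2.2 = stdSimplex.const 1 0 n then F n (z.1, z.2.1) else f n (z.1, z.2.1)
  have hc₁ : ∀ n (x : X.obj n) (y : Y.obj n) (t : (Δ[1] : SSet.{w}).obj n),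
      (x ∈ A.obj n ∨ x ∈ B.obj n ∧ y ∈ S.obj n ∨ t = stdSimplex.const 1 1 n) →
      c n (x, y, t) = f n (x, y) := by
    intro n x y t h
    dsimp only [c]
    split_ifs with ht
    · rcases h with h | h | h
      · exact hFf n x y (Or.inl h)
      · exact hFf n x y (Or.inr h)
      · exact absurd (h.symm.trans ht) const_ne
    · rfl
  let q : X ⊗ (Y ⊗ Δ[1]) ⟶ X ⊗ Y := X ◁ CartesianMonoidalCategory.fst _ _
  let S' : (Y ⊗ Δ[1] : SSet.{w}).Subcomplex := S.prod ⊤ ⊔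
    ((⊤ : Y.Subcomplex).prod (endpoint 0) ⊔ (⊤ : Y.Subcomplex).prod (endpoint 1))
  have hc : IsMapOn (A.prod ⊤ ⊔ L.prod S') c := by
    have e₁ : IsMapOn (A.prod ⊤) c := by
      refine (hf.comp q ?_).congr ?_
      · rintro n ⟨x, y, t⟩ ⟨hx, -⟩
        exact Or.inl ⟨hAL _ hx, trivial⟩
      · rintro n ⟨x, y, t⟩ ⟨hx, -⟩
        exact hc₁ n x y t (Or.inl hx)
    have e₂ : IsMapOn (L.prod (S.prod ⊤)) c := by
      refine (hf.comp q ?_).congr ?_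
      · rintro n ⟨x, y, t⟩ ⟨hx, hy, -⟩
        exact Or.inl ⟨hx, trivial⟩
      · rintro n ⟨x, y, t⟩ ⟨hx, hy, -⟩
        exact hc₁ n x y t (Or.inr (Or.inl ⟨hLB _ hx, hy⟩))
    have e₃ : IsMapOn (L.prod ((⊤ : Y.Subcomplex).prod (endpoint 0))) c := by
      refine (hF.comp q ?_).congr ?_
      · rintro n ⟨x, y, t⟩ ⟨hx, hy, -⟩
        exact ⟨hLB _ hx, trivial⟩
      · rintro n ⟨x, y, t⟩ ⟨hx, hy, ht⟩
        exact if_pos ht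
    have e₄ : IsMapOn (L.prod ((⊤ : Y.Subcomplex).prod (endpoint 1))) c := by
      refine (hf.comp q ?_).congr ?_
      · rintro n ⟨x, y, t⟩ ⟨hx, hy, -⟩
        exact Or.inl ⟨hx, trivial⟩
      · rintro n ⟨x, y, t⟩ ⟨hx, hy, ht⟩
        exact hc₁ n x y t (Or.inr (Or.inr ht))
    refine ((e₁.sup e₂).sup (e₃.sup e₄)).mono ?_
    rintro n ⟨x, y, t⟩ (⟨hx, -⟩ | ⟨hx, hy | hy | hy⟩)
    · exact Or.inl (Or.inl ⟨hx, trivial⟩)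
    · exact Or.inl (Or.inr ⟨hx, hy⟩)
    · exact Or.inr (Or.inl ⟨hx, hy⟩)
    · exact Or.inr (Or.inr ⟨hx, hy⟩)
  obtain ⟨H, hH, hHc⟩ := h₁ K (Y ⊗ Δ[1]) S' c hc
  have hH₀ : ∀ n (x : X.obj n) (y : Y.obj n), x ∈ L.obj n →
      H n (x, y, stdSimplex.const 1 0 n) = F n (x, y) := fun n x y hx =>
    (hHc n x (y, _) (Or.inr ⟨hx, Or.inr (Or.inl ⟨trivial, rfl⟩)⟩)).trans (if_pos rfl)
  have hH₁ : ∀ n (x : X.obj n) (y : Y.obj n), x ∈ L.obj n →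
      H n (x, y, stdSimplex.const 1 1 n) = f n (x, y) := fun n x y hx =>
    (hHc n x (y, _) (Or.inr ⟨hx, Or.inr (Or.inr ⟨trivial, rfl⟩)⟩)).trans (if_neg const_ne)
  have hHS : ∀ n (x : X.obj n) (y : Y.obj n) (t : (Δ[1] : SSet.{w}).obj n), x ∈ L.obj n →
      y ∈ S.obj n → H n (x, y, t) = f n (x, y) := fun n x y t hx hy =>
    (hHc n x (y, t) (Or.inr ⟨hx, Or.inl ⟨hy, trivial⟩⟩)).trans
      (hc₁ n x y t (Or.inr (Or.inl ⟨hLB _ hx, hy⟩)))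
  let d : ∀ n, ((X ⊗ Y) ⊗ Δ[1]).obj n → K.obj n := fun n z =>
    if z.2 = stdSimplex.const 1 0 n then F n z.1
      else if z.1.1 ∈ L.obj n then H n (z.1.1, z.1.2, z.2) else f n z.1
  have hdL : ∀ n (x : X.obj n) (y : Y.obj n) (t : (Δ[1] : SSet.{w}).obj n), x ∈ L.obj n →
      d n ((x, y), t) = H n (x, y, t) := by
    intro n x y t hx
    dsimp only [d]
    split_ifs with ht
    · rw [ht, hH₀ n x y hx]
    · rfl
  have hdS : ∀ n (x : X.obj n) (y : Y.obj n) (t : (Δ[1] : SSet.{w}).obj n), x ∈ B.obj n →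
      y ∈ S.obj n → d n ((x, y), t) = f n (x, y) := by
    intro n x y t hx hy
    dsimp only [d]
    split_ifs with ht hL
    · exact hFf n x y (Or.inr ⟨hx, hy⟩)
    · exact hHS n x y t hL hy
    · rfl
  have hd : IsMapOn ((B.prod (⊤ : Y.Subcomplex)).prod (endpoint 0) ⊔
      (L.prod (⊤ : Y.Subcomplex) ⊔ B.prod S).prod ⊤) d := by
    have e₁ : IsMapOn ((B.prod (⊤ : Y.Subcomplex)).prod (endpoint 0)) d := by
      refine (hF.comp (CartesianMonoidalCategory.fst (X ⊗ Y) Δ[1]) ?_).congr ?_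
      · rintro n ⟨⟨x, y⟩, t⟩ ⟨hx, -⟩
        exact hx
      · rintro n ⟨⟨x, y⟩, t⟩ ⟨hx, ht⟩
        exact if_pos ht
    have e₂ : IsMapOn ((L.prod (⊤ : Y.Subcomplex)).prod ⊤) d := by
      refine (hH.comp (α_ X Y Δ[1]).hom ?_).congr ?_
      · rintro n ⟨⟨x, y⟩, t⟩ ⟨⟨hx, -⟩, -⟩
        exact ⟨hx, trivial⟩
      · rintro n ⟨⟨x, y⟩, t⟩ ⟨⟨hx, -⟩, -⟩
        exact hdL n x y t hx
    have e₃ : IsMapOn ((B.prod S).prod ⊤) d := by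
      refine (hf.comp (CartesianMonoidalCategory.fst (X ⊗ Y) Δ[1]) ?_).congr ?_
      · rintro n ⟨⟨x, y⟩, t⟩ ⟨hx, -⟩
        exact Or.inr hx
      · rintro n ⟨⟨x, y⟩, t⟩ ⟨⟨hx, hy⟩, -⟩
        exact hdS n x y t hx hy
    refine (e₁.sup (e₂.sup e₃)).mono ?_
    rintro n ⟨⟨x, y⟩, t⟩ (h | ⟨h | h, -⟩)
    · exact Or.inl h
    · exact Or.inr (Or.inl ⟨h, trivial⟩)
    · exact Or.inr (Or.inr ⟨h, trivial⟩)
  obtain ⟨G, hG, hGd⟩ := hd.exists_cylinder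
  refine ⟨fun n z => G n (z, stdSimplex.const 1 1 n), ?_, ?_⟩
  · exact hG.comp ι₁ fun n z hz => ⟨hz, trivial⟩
  · rintro n x y (hx | ⟨hx, hy⟩)
    · exact (hGd n (x, y) _ ⟨hLB _ hx, trivial⟩ (Or.inr (Or.inl ⟨hx, trivial⟩))).trans
        ((hdL n x y _ hx).trans (hH₁ n x y hx))
    · exact (hGd n (x, y) _ ⟨hx, trivial⟩ (Or.inr (Or.inr ⟨hx, hy⟩))).trans (hdS n x y _ hx hy)

/-- If the identity of `X` and an idempotent `r` with image `D` are connected by a zig-zag of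
homotopies which preserve the subcomplex `B`, then `D ⊓ B ⟶ B` is acyclic. -/
lemma of_zigzag {B D : X.Subcomplex} (r : X ⟶ X) (h₀ h₁ : X ⊗ Δ[1] ⟶ X)
    (h₀_zero : ∀ n (x : X.obj n), h₀.app n (x, stdSimplex.const 1 0 n) = x)
    (h₁_zero : ∀ n (x : X.obj n), h₁.app n (x, stdSimplex.const 1 0 n) = r.app n x)
    (h_one : ∀ n (x : X.obj n), h₀.app n (x, stdSimplex.const 1 1 n) =
      h₁.app n (x, stdSimplex.const 1 1 n))
    (h₀_mem : ∀ n (x : X.obj n) (t : (Δ[1] : SSet.{w}).obj n), x ∈ B.obj n →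
      h₀.app n (x, t) ∈ B.obj n)
    (h₁_mem : ∀ n (x : X.obj n) (t : (Δ[1] : SSet.{w}).obj n), x ∈ B.obj n →
      h₁.app n (x, t) ∈ B.obj n)
    (r_mem : ∀ n (x : X.obj n), r.app n x ∈ D.obj n)
    (r_eq : ∀ n (x : X.obj n), x ∈ D.obj n → r.app n x = x) : IsAcyclicPair (D ⊓ B) B := by
  classical
  intro K _ Y S f hf
  have r_memB : ∀ n (x : X.obj n), x ∈ B.obj n → r.app n x ∈ B.obj n := fun n x hx => by
    rw [← h₁_zero]
    exact h₁_mem n x _ hx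
  have hfS : IsMapOn (B.prod S) f := hf.mono le_sup_right
  have hfD : IsMapOn ((D ⊓ B).prod ⊤) f := hf.mono le_sup_left
  -- concatenation of the two homotopies
  have hγ : ∃ γ : ∀ n, ((X ⊗ Y) ⊗ Δ[1]).obj n → K.obj n, IsMapOn ((B.prod S).prod ⊤) γ ∧
      (∀ n (x : X.obj n) (y : Y.obj n), x ∈ B.obj n → y ∈ S.obj n →
        γ n ((x, y), stdSimplex.const 1 0 n) = f n (r.app n x, y)) ∧
      (∀ n (x : X.obj n) (y : Y.obj n), x ∈ B.obj n → y ∈ S.obj n →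
        γ n ((x, y), stdSimplex.const 1 1 n) = f n (x, y)) := by
    -- In the square with coordinates `(s, t)`, the side `s = 0` is `h₁`, the side `s = 1` is `h₀`,
    -- and `t = 1` is their common end. After filling, the side `t = 0` runs from `f ∘ r` to `f`.
    let c : ∀ n, (((X ⊗ Y) ⊗ Δ[1]) ⊗ Δ[1]).obj n → K.obj n := fun n z =>
      if z.2 = stdSimplex.const 1 1 n then f n (h₁.app n (z.1.1.1, z.2), z.1.1.2)
      else if z.1.2 = stdSimplex.const 1 0 n then f n (h₁.app n (z.1.1.1, z.2), z.1.1.2)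
      else f n (h₀.app n (z.1.1.1, z.2), z.1.1.2)
    have c₁ : ∀ n (x : X.obj n) (y : Y.obj n) (s t : (Δ[1] : SSet.{w}).obj n),
        (t = stdSimplex.const 1 1 n ∨ s = stdSimplex.const 1 0 n) →
        c n (((x, y), s), t) = f n (h₁.app n (x, t), y) := by
      intro n x y s t h
      dsimp only [c]
      split_ifs with ht hs
      · rfl
      · rfl
      · tauto
    have c₀ : ∀ n (x : X.obj n) (y : Y.obj n) (s t : (Δ[1] : SSet.{w}).obj n),
        (t = stdSimplex.const 1 1 n ∨ s = stdSimplex.const 1 1 n) →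
        c n (((x, y), s), t) = f n (h₀.app n (x, t), y) := by
      intro n x y s t h
      dsimp only [c]
      split_ifs with ht hs
      · rw [ht, h_one]
      · exact absurd ((h.resolve_left ht).symm.trans hs) const_ne
      · rfl
    let q : ((X ⊗ Y) ⊗ Δ[1]) ⊗ Δ[1] ⟶ (X ⊗ Δ[1]) ⊗ Y :=
      CartesianMonoidalCategory.lift
        (CartesianMonoidalCategory.lift
          (CartesianMonoidalCategory.fst _ _ ≫ CartesianMonoidalCategory.fst _ _ ≫
            CartesianMonoidalCategory.fst _ _) (CartesianMonoidalCategory.snd _ _))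
        (CartesianMonoidalCategory.fst _ _ ≫ CartesianMonoidalCategory.fst _ _ ≫
            CartesianMonoidalCategory.snd _ _)
    have e₁ : IsMapOn (((B.prod S).prod ⊤).prod (endpoint 1)) c := by
      refine (hfS.comp (q ≫ h₁ ▷ Y) ?_).congr ?_
      · rintro n ⟨⟨⟨x, y⟩, s⟩, t⟩ ⟨⟨⟨hx, hy⟩, -⟩, -⟩
        exact ⟨h₁_mem n x t hx, hy⟩
      · rintro n ⟨⟨⟨x, y⟩, s⟩, t⟩ ⟨-, ht⟩
        exact c₁ n x y s t (Or.inl ht)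
    have e₂ : IsMapOn (((B.prod S).prod (endpoint 0)).prod ⊤) c := by
      refine (hfS.comp (q ≫ h₁ ▷ Y) ?_).congr ?_
      · rintro n ⟨⟨⟨x, y⟩, s⟩, t⟩ ⟨⟨⟨hx, hy⟩, -⟩, -⟩
        exact ⟨h₁_mem n x t hx, hy⟩
      · rintro n ⟨⟨⟨x, y⟩, s⟩, t⟩ ⟨⟨-, hs⟩, -⟩
        exact c₁ n x y s t (Or.inr hs)
    have e₃ : IsMapOn (((B.prod S).prod (endpoint 1)).prod ⊤) c := by
      refine (hfS.comp (q ≫ h₀ ▷ Y) ?_).congr ?_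
      · rintro n ⟨⟨⟨x, y⟩, s⟩, t⟩ ⟨⟨⟨hx, hy⟩, -⟩, -⟩
        exact ⟨h₀_mem n x t hx, hy⟩
      · rintro n ⟨⟨⟨x, y⟩, s⟩, t⟩ ⟨⟨-, hs⟩, -⟩
        exact c₀ n x y s t (Or.inr hs)
    have hc : IsMapOn (((B.prod S).prod ⊤).prod (endpoint 1) ⊔
        ((B.prod S).prod (endpoint 0) ⊔ (B.prod S).prod (endpoint 1)).prod ⊤) c := by
      refine (e₁.sup (e₂.sup e₃)).mono ?_
      rintro n ⟨z, t⟩ (h | ⟨h | h, -⟩)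
      · exact Or.inl h
      · exact Or.inr (Or.inl ⟨h, trivial⟩)
      · exact Or.inr (Or.inr ⟨h, trivial⟩)
    obtain ⟨G, hG, hGc⟩ := hc.exists_cylinder
    refine ⟨fun n z => G n (z, stdSimplex.const 1 0 n), ?_, ?_, ?_⟩
    · exact hG.comp ι₀ fun n z hz => ⟨hz, trivial⟩
    · intro n x y hx hy
      refine (hGc n ((x, y), _) _ ⟨⟨hx, hy⟩, trivial⟩
        (Or.inr (Or.inl ⟨⟨hx, hy⟩, rfl⟩))).trans ((c₁ n x y _ _ (Or.inr rfl)).trans ?_)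
      rw [h₁_zero]
    · intro n x y hx hy
      refine (hGc n ((x, y), _) _ ⟨⟨hx, hy⟩, trivial⟩
        (Or.inr (Or.inr ⟨⟨hx, hy⟩, rfl⟩))).trans ((c₀ n x y _ _ (Or.inr rfl)).trans ?_)
      rw [h₀_zero]
  obtain ⟨γ, hγ, γ₀, γ₁⟩ := hγ
  -- a homotopy with the same ends which is constant on `D`
  have hk : ∃ k : ∀ n, ((X ⊗ Y) ⊗ Δ[1]).obj n → K.obj n, IsMapOn ((B.prod S).prod ⊤) k ∧
      (∀ n (x : X.obj n) (y : Y.obj n), x ∈ B.obj n → y ∈ S.obj n →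
        k n ((x, y), stdSimplex.const 1 0 n) = f n (r.app n x, y)) ∧
      (∀ n (x : X.obj n) (y : Y.obj n), x ∈ B.obj n → y ∈ S.obj n →
        k n ((x, y), stdSimplex.const 1 1 n) = f n (x, y)) ∧
      (∀ n (x : X.obj n) (y : Y.obj n) (t : (Δ[1] : SSet.{w}).obj n), x ∈ B.obj n →
        y ∈ S.obj n → x ∈ D.obj n → k n ((x, y), t) = f n (x, y)) := by
    -- The side `s = 0` is the loop `γ (r x)`, the side `s = 1` is `γ x`, and `t = 0` is constant at
    -- `f (r x)`. For `x` in `D` the two sides coincide, so the filling is prescribed there to be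
    -- independent of `s`; the side `t = 1` is the new homotopy.
    let c : ∀ n, (((X ⊗ Y) ⊗ Δ[1]) ⊗ Δ[1]).obj n → K.obj n := fun n z =>
      if z.1.2 = stdSimplex.const 1 0 n then γ n ((r.app n z.1.1.1, z.1.1.2), z.2)
      else if z.2 = stdSimplex.const 1 0 n then f n (r.app n z.1.1.1, z.1.1.2)
      else γ n (z.1.1, z.2)
    have cs₀ : ∀ n (x : X.obj n) (y : Y.obj n) (t : (Δ[1] : SSet.{w}).obj n),
        c n (((x, y), stdSimplex.const 1 0 n), t) = γ n ((r.app n x, y), t) :=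
      fun n x y t => if_pos rfl
    have cs₁ : ∀ n (x : X.obj n) (y : Y.obj n) (t : (Δ[1] : SSet.{w}).obj n), x ∈ B.obj n →
        y ∈ S.obj n → c n (((x, y), stdSimplex.const 1 1 n), t) = γ n ((x, y), t) := by
      intro n x y t hx hy
      refine (if_neg const_ne).trans ?_
      dsimp only
      split_ifs with ht
      · rw [ht, γ₀ n x y hx hy]
      · rfl
    have ct₀ : ∀ n (x : X.obj n) (y : Y.obj n) (s : (Δ[1] : SSet.{w}).obj n), x ∈ B.obj n →
        y ∈ S.obj n → c n (((x, y), s), stdSimplex.const 1 0 n) = f n (r.app n x, y) := by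
      intro n x y s hx hy
      dsimp only [c]
      split_ifs with hs h
      · rw [γ₀ n _ y (r_memB n x hx) hy, r_eq n _ (r_mem n x)]
      · rfl
      · exact absurd rfl h
    have cD : ∀ n (x : X.obj n) (y : Y.obj n) (s t : (Δ[1] : SSet.{w}).obj n), x ∈ B.obj n →
        y ∈ S.obj n → x ∈ D.obj n → c n (((x, y), s), t) = γ n ((x, y), t) := by
      intro n x y s t hx hy hD
      dsimp only [c]
      split_ifs with hs ht
      · rw [r_eq n x hD]
      · rw [ht, γ₀ n x y hx hy]
      · rfl
    have e₁ : IsMapOn (((B.prod S).prod ⊤).prod (endpoint 0)) c := by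
      refine (hfS.comp (CartesianMonoidalCategory.fst _ _ ≫ CartesianMonoidalCategory.fst _ _ ≫
        r ▷ Y) ?_).congr ?_
      · rintro n ⟨⟨⟨x, y⟩, s⟩, t⟩ ⟨⟨⟨hx, hy⟩, -⟩, -⟩
        exact ⟨r_memB n x hx, hy⟩
      · rintro n ⟨⟨⟨x, y⟩, s⟩, t⟩ ⟨⟨⟨hx, hy⟩, -⟩, ht⟩
        obtain rfl : t = _ := ht
        exact ct₀ n x y s hx hy
    have e₂ : IsMapOn (((B.prod S).prod (endpoint 0)).prod ⊤) c := by
      refine (hγ.comp ((CartesianMonoidalCategory.fst _ _ ≫ r ▷ Y) ▷ Δ[1]) ?_).congr ?_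
      · rintro n ⟨⟨⟨x, y⟩, s⟩, t⟩ ⟨⟨⟨hx, hy⟩, -⟩, -⟩
        exact ⟨⟨r_memB n x hx, hy⟩, trivial⟩
      · rintro n ⟨⟨⟨x, y⟩, s⟩, t⟩ ⟨⟨-, hs⟩, -⟩
        obtain rfl : s = _ := hs
        exact cs₀ n x y t
    have e₃ : IsMapOn (((B.prod S).prod (endpoint 1)).prod ⊤) c := by
      refine (hγ.comp (CartesianMonoidalCategory.fst _ _ ▷ Δ[1]) ?_).congr ?_
      · rintro n ⟨⟨⟨x, y⟩, s⟩, t⟩ ⟨⟨⟨hx, hy⟩, -⟩, -⟩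
        exact ⟨⟨hx, hy⟩, trivial⟩
      · rintro n ⟨⟨⟨x, y⟩, s⟩, t⟩ ⟨⟨⟨hx, hy⟩, hs⟩, -⟩
        obtain rfl : s = _ := hs
        exact cs₁ n x y t hx hy
    have e₄ : IsMapOn ((((D ⊓ B).prod S).prod ⊤).prod ⊤) c := by
      refine (hγ.comp (CartesianMonoidalCategory.fst _ _ ▷ Δ[1]) ?_).congr ?_
      · rintro n ⟨⟨⟨x, y⟩, s⟩, t⟩ ⟨⟨⟨hx, hy⟩, -⟩, -⟩
        exact ⟨⟨hx.2, hy⟩, trivial⟩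
      · rintro n ⟨⟨⟨x, y⟩, s⟩, t⟩ ⟨⟨⟨hx, hy⟩, -⟩, -⟩
        exact cD n x y s t hx.2 hy hx.1
    have hc : IsMapOn (((B.prod S).prod ⊤).prod (endpoint 0) ⊔
        ((B.prod S).prod (endpoint 0) ⊔ (B.prod S).prod (endpoint 1) ⊔
          ((D ⊓ B).prod S).prod ⊤).prod ⊤) c := by
      refine (e₁.sup ((e₂.sup e₃).sup e₄)).mono ?_
      rintro n ⟨z, t⟩ (h | ⟨(h | h) | h, -⟩)
      · exact Or.inl h
      · exact Or.inr (Or.inl (Or.inl ⟨h, trivial⟩))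
      · exact Or.inr (Or.inl (Or.inr ⟨h, trivial⟩))
      · exact Or.inr (Or.inr ⟨h, trivial⟩)
    obtain ⟨G, hG, hGc⟩ := hc.exists_cylinder
    refine ⟨fun n z => G n (z, stdSimplex.const 1 1 n), ?_, ?_, ?_, ?_⟩
    · exact hG.comp ι₁ fun n z hz => ⟨hz, trivial⟩
    · intro n x y hx hy
      refine (hGc n ((x, y), _) _ ⟨⟨hx, hy⟩, trivial⟩
        (Or.inr (Or.inl (Or.inl ⟨⟨hx, hy⟩, rfl⟩)))).trans
          ((cs₀ n x y _).trans (γ₁ n _ y (r_memB n x hx) hy))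
    · intro n x y hx hy
      refine (hGc n ((x, y), _) _ ⟨⟨hx, hy⟩, trivial⟩
        (Or.inr (Or.inl (Or.inr ⟨⟨hx, hy⟩, rfl⟩)))).trans
          ((cs₁ n x y _ hx hy).trans (γ₁ n x y hx hy))
    · intro n x y t hx hy hD
      refine (hGc n ((x, y), _) _ ⟨⟨hx, hy⟩, trivial⟩
        (Or.inr (Or.inr ⟨⟨⟨hD, hx⟩, hy⟩, trivial⟩))).trans
          ((cD n x y _ _ hx hy hD).trans (γ₁ n x y hx hy))
  obtain ⟨k, hk, k₀, k₁, kD⟩ := hk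
  -- The map `f ∘ r` makes sense on all of `B × Y`. It is deformed by homotopy extension along `k`
  -- on `B × S` and the constant homotopy on `(D ∩ B) × Y`, which are compatible because `k` is
  -- constant on `D`.
  let d : ∀ n, ((X ⊗ Y) ⊗ Δ[1]).obj n → K.obj n := fun n z =>
    if z.2 = stdSimplex.const 1 0 n then f n (r.app n z.1.1, z.1.2)
      else if z.1.1 ∈ D.obj n then f n z.1 else k n z
  have d₀ : ∀ n (x : X.obj n) (y : Y.obj n),
      d n ((x, y), stdSimplex.const 1 0 n) = f n (r.app n x, y) := fun n x y => if_pos rfl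
  have dD : ∀ n (x : X.obj n) (y : Y.obj n) (t : (Δ[1] : SSet.{w}).obj n), x ∈ D.obj n →
      d n ((x, y), t) = f n (x, y) := by
    intro n x y t hx
    dsimp only [d]
    split_ifs with ht
    · rw [r_eq n x hx]
    · rfl
  have dS : ∀ n (x : X.obj n) (y : Y.obj n) (t : (Δ[1] : SSet.{w}).obj n), x ∈ B.obj n →
      y ∈ S.obj n → d n ((x, y), t) = k n ((x, y), t) := by
    intro n x y t hx hy
    dsimp only [d]
    split_ifs with ht hD
    · rw [ht, k₀ n x y hx hy]
    · rw [kD n x y t hx hy hD]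
    · rfl
  have e₁ : IsMapOn ((B.prod (⊤ : Y.Subcomplex)).prod (endpoint 0)) d := by
    refine (hfD.comp (CartesianMonoidalCategory.fst _ _ ≫ r ▷ Y) ?_).congr ?_
    · rintro n ⟨⟨x, y⟩, t⟩ ⟨⟨hx, -⟩, -⟩
      exact ⟨⟨r_mem n x, r_memB n x hx⟩, trivial⟩
    · rintro n ⟨⟨x, y⟩, t⟩ ⟨-, ht⟩
      obtain rfl : t = _ := ht
      exact d₀ n x y
  have e₂ : IsMapOn (((D ⊓ B).prod (⊤ : Y.Subcomplex)).prod ⊤) d := by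
    refine (hfD.comp (CartesianMonoidalCategory.fst _ _) ?_).congr ?_
    · rintro n ⟨⟨x, y⟩, t⟩ ⟨hx, -⟩
      exact hx
    · rintro n ⟨⟨x, y⟩, t⟩ ⟨⟨hx, -⟩, -⟩
      exact dD n x y t hx.1
  have e₃ : IsMapOn ((B.prod S).prod ⊤) d := by
    refine hk.congr ?_
    rintro n ⟨⟨x, y⟩, t⟩ ⟨⟨hx, hy⟩, -⟩
    exact dS n x y t hx hy
  have hd : IsMapOn ((B.prod (⊤ : Y.Subcomplex)).prod (endpoint 0) ⊔
      ((D ⊓ B).prod (⊤ : Y.Subcomplex) ⊔ B.prod S).prod ⊤) d := by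
    refine (e₁.sup (e₂.sup e₃)).mono ?_
    rintro n ⟨z, t⟩ (h | ⟨h | h, -⟩)
    · exact Or.inl h
    · exact Or.inr (Or.inl ⟨h, trivial⟩)
    · exact Or.inr (Or.inr ⟨h, trivial⟩)
  obtain ⟨G, hG, hGd⟩ := hd.exists_cylinder
  refine ⟨fun n z => G n (z, stdSimplex.const 1 1 n), ?_, ?_⟩
  · exact hG.comp ι₁ fun n z hz => ⟨hz, trivial⟩
  · rintro n x y (hx | ⟨hx, hy⟩)
    · exact (hGd n (x, y) _ ⟨hx.2, trivial⟩ (Or.inr (Or.inl ⟨hx, trivial⟩))).trans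
        (dD n x y _ hx.1)
    · exact (hGd n (x, y) _ ⟨hx, trivial⟩ (Or.inr (Or.inr ⟨hx, hy⟩))).trans
        ((dS n x y _ hx hy).trans (k₁ n x y hx hy))

/-! ### Stability of acyclic pairs, and weak equivalences. -/

variable {Z : SSet.{w}}

/-- Pushout-products are associative: test `L` against `T × Y ∪ Z × S` inside `Z × Y`. -/
lemma unionProd {L : X.Subcomplex} (h : IsAcyclicPair L ⊤) (T : Z.Subcomplex) :
    IsAcyclicPair (L.unionProd T) ⊤ := by
  intro K _ Y S f hf
  obtain ⟨F, hF, hFf⟩ := h K (Z ⊗ Y) (T.prod ⊤ ⊔ (⊤ : Z.Subcomplex).prod S)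
    (fun n z => f n ((α_ X Z Y).inv.app n z)) (by
      refine hf.comp (α_ X Z Y).inv ?_
      rintro n ⟨x, z, y⟩ (⟨hx, -⟩ | ⟨-, ⟨hz, -⟩ | ⟨-, hy⟩⟩)
      · exact Or.inl ⟨Or.inr ⟨hx, trivial⟩, trivial⟩
      · exact Or.inl ⟨Or.inl ⟨trivial, hz⟩, trivial⟩
      · exact Or.inr ⟨trivial, hy⟩)
  refine ⟨fun n z => F n ((α_ X Z Y).hom.app n z),
    hF.comp (α_ X Z Y).hom fun _ _ _ => ⟨trivial, trivial⟩, ?_⟩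
  rintro n ⟨x, z⟩ y ((⟨-, hz⟩ | ⟨hx, -⟩) | ⟨-, hy⟩)
  · exact hFf n x (z, y) (Or.inr ⟨trivial, Or.inl ⟨hz, trivial⟩⟩)
  · exact hFf n x (z, y) (Or.inl hx)
  · exact hFf n x (z, y) (Or.inr ⟨trivial, Or.inr ⟨trivial, hy⟩⟩)

/-- Acyclic pairs are stable under cobase change. -/
lemma of_map {A : X.Subcomplex} {A' : X'.Subcomplex} (h : IsAcyclicPair A' ⊤) (φ : X' ⟶ X)
    (hA : ∀ n (x : X'.obj n), φ.app n x ∈ A.obj n ↔ x ∈ A'.obj n)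
    (hφ : ∀ n (x y : X'.obj n), φ.app n x ∉ A.obj n → φ.app n x = φ.app n y → x = y) :
    IsAcyclicPair A (A ⊔ Subcomplex.range φ) := by
  classical
  intro K _ Y S f hf
  obtain ⟨F, hF, hFf⟩ := h K Y S (fun n z => f n ((φ ▷ Y).app n z)) (by
    refine hf.comp (φ ▷ Y) ?_
    rintro n ⟨x, y⟩ (⟨hx, -⟩ | ⟨-, hy⟩)
    · exact Or.inl ⟨(hA n x).2 hx, trivial⟩
    · exact Or.inr ⟨Or.inr ⟨x, rfl⟩, hy⟩)
  -- Outside `A` the chosen preimage is unique by `hφ`; over `A`, the map `F` already agrees with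
  -- `f`.
  let G : ∀ n, (X ⊗ Y).obj n → K.obj n := fun n z =>
    if z.1 ∈ A.obj n then f n z
      else if h : ∃ x', φ.app n x' = z.1 then F n (h.choose, z.2) else f n z
  have hGA : ∀ n (x : X.obj n) (y : Y.obj n), x ∈ A.obj n → G n (x, y) = f n (x, y) :=
    fun n x y hx => if_pos hx
  have hGφ : ∀ n (x : X'.obj n) (y : Y.obj n), G n (φ.app n x, y) = F n (x, y) := by
    intro n x y
    by_cases hx : φ.app n x ∈ A.obj n
    · rw [hGA n _ y hx]
      exact (hFf n x y (Or.inl ((hA n x).1 hx))).symm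
    · have hex : ∃ x', φ.app n x' = φ.app n x := ⟨x, rfl⟩
      refine (if_neg hx).trans ((dif_pos hex).trans ?_)
      exact congrArg (fun x' => F n ((x', y) : (X' ⊗ Y).obj n))
        (hφ n x _ hx hex.choose_spec.symm).symm
  refine ⟨G, ?_, ?_⟩
  · have e₁ : IsMapOn (A.prod (⊤ : Y.Subcomplex)) G :=
      (hf.mono le_sup_left).congr fun n z hz => hGA n z.1 z.2 hz.1
    have e₂ : IsMapOn ((Subcomplex.range φ).prod (⊤ : Y.Subcomplex)) G := by
      rintro n m g ⟨_, y⟩ ⟨⟨x, rfl⟩, -⟩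
      refine Eq.trans ?_ ((hGφ m (X'.map g x) (Y.map g y)).trans
        ((hF g (x, y) ⟨trivial, trivial⟩).trans (congrArg _ (hGφ n x y).symm)))
      rw [NatTrans.naturality_apply]
      rfl
    refine (e₁.sup e₂).mono ?_
    rintro n ⟨x, y⟩ ⟨hx | hx, -⟩
    · exact Or.inl ⟨hx, trivial⟩
    · exact Or.inr ⟨hx, trivial⟩
  · rintro n x y (hx | ⟨hx | ⟨x, rfl⟩, hy⟩)
    · exact hGA n x y hx
    · exact hGA n x y hx
    · rw [hGφ]
      exact hFf n x y (Or.inr ⟨trivial, hy⟩)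

/-- Acyclic pairs are stable under sequential composition. -/
lemma of_sequence {F : ℕ → X.Subcomplex} (hF : Monotone F)
    (h : ∀ q, IsAcyclicPair (F q) (F (q + 1))) : IsAcyclicPair (F 0) (⨆ q, F q) := by
  classical
  intro K _ Y S f hf
  let P (q : ℕ) (g : ∀ n, (X ⊗ Y).obj n → K.obj n) : Prop :=
    IsMapOn ((F q).prod (⊤ : Y.Subcomplex)) g ∧
      ∀ n (x : X.obj n) (y : Y.obj n), x ∈ (F q).obj n → y ∈ S.obj n → g n (x, y) = f n (x, y)
  have hmem : ∀ q n (x : X.obj n), x ∈ (F q).obj n → x ∈ (⨆ q, F q).obj n :=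
    fun q n x hx => le_iSup F q n hx
  have hnext : ∀ q (g : ∀ n, (X ⊗ Y).obj n → K.obj n), P q g → ∃ g', P (q + 1) g' ∧
      ∀ n (x : X.obj n) (y : Y.obj n), x ∈ (F q).obj n → g' n (x, y) = g n (x, y) := by
    rintro q g ⟨hg, hgf⟩
    let c : ∀ n, (X ⊗ Y).obj n → K.obj n := fun n z => if z.1 ∈ (F q).obj n then g n z else f n z
    have hcS : ∀ n (x : X.obj n) (y : Y.obj n), y ∈ S.obj n → c n (x, y) = f n (x, y) := by
      intro n x y hy
      dsimp only [c]
      split_ifs with hx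
      · exact hgf n x y hx hy
      · rfl
    have e₁ : IsMapOn ((F q).prod (⊤ : Y.Subcomplex)) c := hg.congr fun n z hz => if_pos hz.1
    have e₂ : IsMapOn ((F (q + 1)).prod S) c := by
      refine (hf.mono ?_).congr fun n z hz => hcS n z.1 z.2 hz.2
      rintro n ⟨x, y⟩ ⟨hx, hy⟩
      exact Or.inr ⟨hmem _ n x hx, hy⟩
    obtain ⟨g', hg', hg'c⟩ := h q K Y S c (e₁.sup e₂)
    refine ⟨g', ⟨hg', fun n x y hx hy => ?_⟩, fun n x y hx => ?_⟩
    · rw [hg'c n x y (Or.inr ⟨hx, hy⟩), hcS n x y hy]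
    · exact (hg'c n x y (Or.inl hx)).trans (if_pos hx)
  choose! next hnextP hnext using hnext
  let G (q : ℕ) : ∀ n, (X ⊗ Y).obj n → K.obj n := Nat.rec f (fun q g => next q g) q
  have hGP : ∀ q, P q (G q) := by
    intro q
    induction q with
    | zero => exact ⟨hf.mono le_sup_left, fun _ _ _ _ _ => rfl⟩
    | succ q ih => exact hnextP q _ ih
  have hG : ∀ p q, p ≤ q → ∀ n (x : X.obj n) (y : Y.obj n), x ∈ (F p).obj n →
      G q n (x, y) = G p n (x, y) := by
    intro p q hpq n x y hx
    induction q, hpq using Nat.le_induction with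
    | base => rfl
    | succ q hpq ih => exact (hnext q _ (hGP q) n x y (hF hpq n hx)).trans ih
  -- Any stage containing the simplex gives the same value, since each stage extends the earlier
  -- ones.
  let H : ∀ n, (X ⊗ Y).obj n → K.obj n := fun n z =>
    if hz : ∃ q, z.1 ∈ (F q).obj n then G (Nat.find hz) n z else f n z
  have hH : ∀ q n (x : X.obj n) (y : Y.obj n), x ∈ (F q).obj n → H n (x, y) = G q n (x, y) := by
    intro q n x y hx
    have hex : ∃ q, x ∈ (F q).obj n := ⟨q, hx⟩
    exact (dif_pos hex).trans (hG _ q (Nat.find_min' hex hx) n x y (Nat.find_spec hex)).symm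
  have hsup : ∀ n (x : X.obj n), x ∈ (⨆ q, F q).obj n → ∃ q, x ∈ (F q).obj n := by
    intro n x hx
    simpa using hx
  refine ⟨H, ?_, ?_⟩
  · rintro n m g ⟨x, y⟩ ⟨hx, -⟩
    obtain ⟨q, hq⟩ := hsup n x hx
    exact (hH q m (X.map g x) (Y.map g y) ((F q).map g hq)).trans
      (((hGP q).1 g (x, y) ⟨hq, trivial⟩).trans (congrArg _ (hH q n x y hq).symm))
  · rintro n x y (hx | ⟨hx, hy⟩)
    · exact hH 0 n x y hx
    · obtain ⟨q, hq⟩ := hsup n x hx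
      exact (hH q n x y hq).trans ((hGP q).2 n x y hq hy)

lemma exists_extension [KanComplex K] {i : X ⟶ Y}
    (h : IsAcyclicPair (Subcomplex.range i) ⊤) (hi : ∀ n, Function.Injective (i.app n))
    (S : Z.Subcomplex) (a : X ⊗ Z ⟶ K) (g : ∀ n, (Y ⊗ Z).obj n → K.obj n)
    (hg : IsMapOn ((⊤ : Y.Subcomplex).prod S) g)
    (hag : ∀ n (x : X.obj n) (z : Z.obj n), z ∈ S.obj n →
      a.app n (x, z) = g n (i.app n x, z)) :
    ∃ b : Y ⊗ Z ⟶ K, i ▷ Z ≫ b = a ∧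
      ∀ n (y : Y.obj n) (z : Z.obj n), z ∈ S.obj n → b.app n (y, z) = g n (y, z) := by
  classical
  let f : ∀ n, (Y ⊗ Z).obj n → K.obj n := fun n z =>
    if h : ∃ x, i.app n x = z.1 then a.app n (h.choose, z.2) else g n z
  have hfi : ∀ n (x : X.obj n) (z : Z.obj n), f n (i.app n x, z) = a.app n (x, z) := by
    intro n x z
    have hex : ∃ x', i.app n x' = i.app n x := ⟨x, rfl⟩
    refine (dif_pos hex).trans ?_
    rw [hi n hex.choose_spec]
  have hfS : ∀ n (y : Y.obj n) (z : Z.obj n), z ∈ S.obj n → f n (y, z) = g n (y, z) := by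
    intro n y z hz
    by_cases hy : ∃ x, i.app n x = y
    · obtain ⟨x, rfl⟩ := hy
      rw [hfi, hag n x z hz]
    · exact dif_neg hy
  have e₁ : IsMapOn ((Subcomplex.range i).prod (⊤ : Z.Subcomplex)) f := by
    rintro n m g ⟨_, z⟩ ⟨⟨x, rfl⟩, -⟩
    refine Eq.trans ?_ ((hfi m (X.map g x) (Z.map g z)).trans
      ((NatTrans.naturality_apply a g ((x, z) : (X ⊗ Z).obj n)).trans
        (congrArg _ (hfi n x z).symm)))
    rw [NatTrans.naturality_apply]
    rfl
  have e₂ : IsMapOn ((⊤ : Y.Subcomplex).prod S) f :=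
    hg.congr fun n z hz => hfS n z.1 z.2 hz.2
  obtain ⟨F, hF, hFf⟩ := h K Z S f (e₁.sup e₂)
  have hF' : IsMapOn ⊤ F := hF.mono fun _ _ _ => ⟨trivial, trivial⟩
  refine ⟨hF'.hom, ?_, fun n y z hz => ?_⟩
  · ext n ⟨x, z⟩
    exact (hFf n (i.app n x) z (Or.inl ⟨x, rfl⟩)).trans (hfi n x z)
  · exact (hFf n y z (Or.inr ⟨trivial, hz⟩)).trans (hfS n y z hz)

/-- The inclusion of an acyclic pair is a weak equivalence. -/
lemma isWeakEquivalence {i : X ⟶ Y} (h : IsAcyclicPair (Subcomplex.range i) ⊤)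
    (hi : ∀ n, Function.Injective (i.app n)) (hX : ∀ n, Y.obj n → Nonempty (X.obj n)) :
    IsWeakEquivalence i := by
  classical
  intro K _
  have ext₁ : ∀ a : X ⟶ K, ∃ b : Y ⟶ K, i ≫ b = a := by
    intro a
    -- With `S = ⊥` the prescribed family is arbitrary; `hX` only supplies some simplex of `K` as a
    -- value.
    obtain ⟨b, hb, -⟩ := h.exists_extension (Z := Δ[0]) hi ⊥
      (CartesianMonoidalCategory.fst _ _ ≫ a)
      (fun n z => a.app n (hX n z.1).some) (fun _ _ _ _ h => h.2.elim) (fun _ _ _ h => h.elim)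
    refine ⟨CartesianMonoidalCategory.lift (𝟙 Y) (SSet.const (stdSimplex.const 0 0 _)) ≫ b, ?_⟩
    ext n x
    exact ConcreteCategory.congr_hom (NatTrans.congr_app hb n)
      ((x, stdSimplex.const 0 0 n) : (X ⊗ Δ[0]).obj n)
  have ext₂ : ∀ (b₀ b₁ : Y ⟶ K), Nonempty (Homotopy (i ≫ b₀) (i ≫ b₁)) →
      Nonempty (Homotopy b₀ b₁) := by
    rintro b₀ b₁ ⟨H⟩
    have H₀ : ∀ n (x : X.obj n), H.h.app n (x, stdSimplex.const 1 0 n) = b₀.app n (i.app n x) :=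
      fun n x => ConcreteCategory.congr_hom (NatTrans.congr_app H.h₀ n) x
    have H₁ : ∀ n (x : X.obj n), H.h.app n (x, stdSimplex.const 1 1 n) = b₁.app n (i.app n x) :=
      fun n x => ConcreteCategory.congr_hom (NatTrans.congr_app H.h₁ n) x
    let g : ∀ n, (Y ⊗ Δ[1]).obj n → K.obj n := fun n z =>
      if z.2 = stdSimplex.const 1 0 n then b₀.app n z.1 else b₁.app n z.1
    have e₀ : IsMapOn ((⊤ : Y.Subcomplex).prod (endpoint 0)) g :=
      (IsMapOn.of_hom (CartesianMonoidalCategory.fst _ _ ≫ b₀) _).congr fun n z hz => if_pos hz.2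
    have e₁ : IsMapOn ((⊤ : Y.Subcomplex).prod (endpoint 1)) g :=
      (IsMapOn.of_hom (CartesianMonoidalCategory.fst _ _ ≫ b₁) _).congr fun n z hz =>
        if_neg fun h => const_ne ((Eq.symm hz.2).trans h)
    obtain ⟨b, -, hb⟩ := h.exists_extension hi (endpoint 0 ⊔ endpoint 1) H.h g
      ((e₀.sup e₁).mono (by
        rintro n ⟨x, t⟩ ⟨-, ht | ht⟩
        · exact Or.inl ⟨trivial, ht⟩
        · exact Or.inr ⟨trivial, ht⟩))
      (by
        rintro n x t (ht | ht)
        · obtain rfl : t = _ := ht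
          exact (H₀ n x).trans (if_pos rfl).symm
        · obtain rfl : t = _ := ht
          exact (H₁ n x).trans (if_neg const_ne).symm)
    refine ⟨{ h := b, h₀ := ?_, h₁ := ?_, rel := ?_ }⟩
    · ext n y
      exact (hb n y _ (Or.inl rfl)).trans (if_pos rfl)
    · ext n y
      exact (hb n y _ (Or.inr rfl)).trans (if_neg const_ne)
    · ext n ⟨⟨_, h⟩, _⟩
      exact h.elim
  -- Homotopy classes use the generated equivalence relation, so a chain of homotopies on `X` is
  -- lifted link by link, its intermediate maps being extended to `Y` by `ext₁`.
  have key : ∀ a₀ a₁ : X ⟶ K, Relation.EqvGen (fun a b => Nonempty (Homotopy a b)) a₀ a₁ →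
      ∀ b₀ b₁ : Y ⟶ K, i ≫ b₀ = a₀ → i ≫ b₁ = a₁ →
      Quot.mk (fun a b : Y ⟶ K => Nonempty (Homotopy a b)) b₀ = Quot.mk _ b₁ := by
    intro a₀ a₁ h
    induction h with
    | rel a₀ a₁ h =>
      rintro b₀ b₁ rfl rfl
      exact Quot.sound (ext₂ b₀ b₁ h)
    | refl a =>
      rintro b₀ b₁ rfl h
      exact Quot.sound (ext₂ b₀ b₁ (by
        rw [h]
        exact ⟨RelativeMorphism.Homotopy.refl _⟩))
    | symm a₀ a₁ _ ih =>
      intro b₀ b₁ h₀ h₁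
      exact (ih b₁ b₀ h₁ h₀).symm
    | trans a₀ a₁ a₂ _ _ ih ih' =>
      intro b₀ b₂ h₀ h₂
      obtain ⟨b₁, h₁⟩ := ext₁ a₁
      exact (ih b₀ b₁ h₀ h₁).trans (ih' b₁ b₂ h₁ h₂)
  constructor
  · rintro ⟨b₀⟩ ⟨b₁⟩ hb
    exact key _ _ (Quot.eqvGen_exact hb) b₀ b₁ rfl rfl
  · rintro ⟨a⟩
    obtain ⟨b, rfl⟩ := ext₁ a
    exact ⟨Quot.mk _ b, rfl⟩

end IsAcyclicPair

/-! ### Front edges, and homotopies which change only them. -/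

/-- The simplicial set `q ↦ B_{n,q}` obtained by fixing the other degree of a bisimplicial set. -/
def slice (B : SimplicialObject SSet.{w}) (n : SimplexCategoryᵒᵖ) : SSet.{w} where
  obj q := (B.obj q).obj n
  map f := (B.map f).app n
  map_id q := by rw [B.map_id]; rfl
  map_comp f g := by rw [B.map_comp]; rfl

/-- The inclusion of the edge `0 → 1` of `⦋q + 1⦌`. -/
def frontEdge (q : ℕ) : ⦋1⦌ ⟶ ⦋q + 1⦌ :=
  SimplexCategory.Hom.mk ⟨Fin.castLE (n := 2) (m := q + 2) (by omega), fun _ _ h => h⟩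

/-- The inclusion of the vertex `0` of `⦋q⦌`. -/
abbrev frontVertex (q : ℕ) : ⦋0⦌ ⟶ ⦋q⦌ := SimplexCategory.const ⦋0⦌ ⦋q⦌ 0

/-- The condition that `(q + 1)`-simplices are pairs consisting of an edge and a `q`-simplex whose
zeroth vertex is the target of the edge. -/
structure HasFrontDecomposition (X : SSet.{w}) : Prop where
  ext : ∀ (q : ℕ) (x y : X.obj (op ⦋q + 1⦌)),
    X.map (frontEdge q).op x = X.map (frontEdge q).op y → X.δ 0 x = X.δ 0 y → x = y
  exists_glue : ∀ (q : ℕ) (e : X.obj (op ⦋1⦌)) (y : X.obj (op ⦋q⦌)),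
    X.δ 0 e = X.map (frontVertex q).op y →
    ∃ x : X.obj (op ⦋q + 1⦌), X.map (frontEdge q).op x = e ∧ X.δ 0 x = y

lemma δ_zero_comp_frontEdge (q : ℕ) :
    SimplexCategory.δ 0 ≫ frontEdge q = frontVertex q ≫ SimplexCategory.δ 0 := by
  ext i : 3
  obtain rfl : i = 0 := Subsingleton.elim (α := Fin 1) i 0
  rfl

lemma frontEdge_comp_σ_zero_comp_δ_zero (q : ℕ) :
    frontEdge q ≫ SimplexCategory.σ 0 ≫ SimplexCategory.δ 0 =
      (SimplexCategory.σ 0 ≫ SimplexCategory.δ 0) ≫ frontEdge q := by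
  ext i : 3
  fin_cases i <;> rfl

/-- A degeneracy of positive index collapses an edge beyond `0 → 1`. This is why homotopies changing
only front edges commute with it. -/
lemma frontEdge_comp_σ_succ (q : ℕ) (i : Fin (q + 1)) :
    frontEdge (q + 1) ≫ SimplexCategory.σ i.succ = frontEdge q := by
  ext j : 3
  change Fin 2 at j
  change i.succ.predAbove (Fin.castLE (n := 2) (m := q + 3) (by omega) j) =
    Fin.castLE (n := 2) (m := q + 2) (by omega) j
  rw [Fin.predAbove_of_le_castSucc _ _ (by
    rw [Fin.le_def]
    simp only [Fin.val_castLE, Fin.val_castSucc, Fin.val_succ]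
    omega)]
  rfl

lemma δ_zero_comp_σ_succ (q : ℕ) (i : Fin (q + 1)) :
    SimplexCategory.δ 0 ≫ SimplexCategory.σ i.succ =
      SimplexCategory.σ i ≫ SimplexCategory.δ 0 := by
  have := SimplexCategory.δ_comp_σ_of_le (i := (0 : Fin (q + 2))) (j := i) (Fin.zero_le _)
  simpa using this

variable {B : SimplicialObject SSet.{w}}

lemma map_map_app {a b c : SimplexCategory} (f : a ⟶ b) (g : b ⟶ c) (n : SimplexCategoryᵒᵖ)
    (x : (B.obj (op c)).obj n) :
    (B.map f.op).app n ((B.map g.op).app n x) = (B.map (f ≫ g).op).app n x := by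
  rw [op_comp, B.map_comp]
  rfl

lemma exists_extendHomotopy_app (hB : ∀ n, (slice B n).HasFrontDecomposition)
    (H : B.obj (op ⦋1⦌) ⊗ Δ[1] ⟶ B.obj (op ⦋1⦌))
    (hH : ∀ n (e : (B.obj (op ⦋1⦌)).obj n) (t : (Δ[1] : SSet.{w}).obj n),
      (B.δ 0).app n (H.app n (e, t)) = (B.δ 0).app n e)
    (q : ℕ) (n : SimplexCategoryᵒᵖ)
    (z : (B.obj (op ⦋q + 1⦌) ⊗ Δ[1] : SSet.{w}).obj n) :
    ∃ x : (B.obj (op ⦋q + 1⦌)).obj n,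
      (B.map (frontEdge q).op).app n x = H.app n ((B.map (frontEdge q).op).app n z.1, z.2) ∧
        (B.δ 0).app n x = (B.δ 0).app n z.1 := by
  refine (hB n).exists_glue q _ _ ?_
  refine (hH n _ _).trans ?_
  refine (map_map_app _ _ n z.1).trans ?_
  rw [δ_zero_comp_frontEdge]
  exact (map_map_app _ _ n z.1).symm

/-- A homotopy on `B_1` which is constant on targets gives a homotopy on `B_{q+1}`, which changes
only the front edges. -/
noncomputable def extendHomotopy (hB : ∀ n, (slice B n).HasFrontDecomposition)
    (H : B.obj (op ⦋1⦌) ⊗ Δ[1] ⟶ B.obj (op ⦋1⦌))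
    (hH : ∀ n (e : (B.obj (op ⦋1⦌)).obj n) (t : (Δ[1] : SSet.{w}).obj n),
      (B.δ 0).app n (H.app n (e, t)) = (B.δ 0).app n e)
    (q : ℕ) :
    B.obj (op ⦋q + 1⦌) ⊗ Δ[1] ⟶ B.obj (op ⦋q + 1⦌) where
  app n := ↾fun z => (exists_extendHomotopy_app hB H hH q n z).choose
  naturality n m g := by
    ext z
    have hz := (exists_extendHomotopy_app hB H hH q n z).choose_spec
    have hz' := (exists_extendHomotopy_app hB H hH q m
      ((B.obj (op ⦋q + 1⦌) ⊗ Δ[1]).map g z)).choose_spec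
    -- The chosen simplex is determined by its front edge and its face `δ 0`, so naturality may be
    -- checked on these.
    refine (hB m).ext q _ _ (hz'.1.trans ?_) (hz'.2.trans ?_)
    · refine Eq.trans ?_ (NatTrans.naturality_apply (B.map (frontEdge q).op) g _).symm
      refine Eq.trans ?_ (congrArg _ hz.1.symm)
      refine Eq.trans ?_ (NatTrans.naturality_apply H g _)
      refine congrArg (fun e => H.app m e) ?_
      exact Prod.ext (NatTrans.naturality_apply (B.map (frontEdge q).op) g z.1) rfl
    · refine Eq.trans ?_ (NatTrans.naturality_apply (B.δ 0) g _).symm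
      refine Eq.trans ?_ (congrArg _ hz.2.symm)
      exact NatTrans.naturality_apply (B.δ 0) g z.1

lemma frontEdge_extendHomotopy (hB : ∀ n, (slice B n).HasFrontDecomposition)
    (H : B.obj (op ⦋1⦌) ⊗ Δ[1] ⟶ B.obj (op ⦋1⦌))
    (hH : ∀ n (e : (B.obj (op ⦋1⦌)).obj n) (t : (Δ[1] : SSet.{w}).obj n),
      (B.δ 0).app n (H.app n (e, t)) = (B.δ 0).app n e)
    (q : ℕ) (n : SimplexCategoryᵒᵖ) (x : (B.obj (op ⦋q + 1⦌)).obj n)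
    (t : (Δ[1] : SSet.{w}).obj n) :
    (B.map (frontEdge q).op).app n ((extendHomotopy hB H hH q).app n (x, t)) =
      H.app n ((B.map (frontEdge q).op).app n x, t) :=
  (exists_extendHomotopy_app hB H hH q n (x, t)).choose_spec.1

lemma δ_zero_extendHomotopy (hB : ∀ n, (slice B n).HasFrontDecomposition)
    (H : B.obj (op ⦋1⦌) ⊗ Δ[1] ⟶ B.obj (op ⦋1⦌))
    (hH : ∀ n (e : (B.obj (op ⦋1⦌)).obj n) (t : (Δ[1] : SSet.{w}).obj n),
      (B.δ 0).app n (H.app n (e, t)) = (B.δ 0).app n e)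
    (q : ℕ) (n : SimplexCategoryᵒᵖ) (x : (B.obj (op ⦋q + 1⦌)).obj n)
    (t : (Δ[1] : SSet.{w}).obj n) :
    (B.δ 0).app n ((extendHomotopy hB H hH q).app n (x, t)) = (B.δ 0).app n x :=
  (exists_extendHomotopy_app hB H hH q n (x, t)).choose_spec.2

lemma extendHomotopy_σ_succ (hB : ∀ n, (slice B n).HasFrontDecomposition)
    (H : B.obj (op ⦋1⦌) ⊗ Δ[1] ⟶ B.obj (op ⦋1⦌))
    (hH : ∀ n (e : (B.obj (op ⦋1⦌)).obj n) (t : (Δ[1] : SSet.{w}).obj n),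
      (B.δ 0).app n (H.app n (e, t)) = (B.δ 0).app n e)
    (q : ℕ) (i : Fin (q + 1)) (n : SimplexCategoryᵒᵖ)
    (y : (B.obj (op ⦋q + 1⦌)).obj n) (t : (Δ[1] : SSet.{w}).obj n) :
    (extendHomotopy hB H hH (q + 1)).app n ((B.σ i.succ).app n y, t) =
      (B.σ i.succ).app n ((extendHomotopy hB H hH q).app n (y, t)) := by
  have e : ∀ z : (B.obj (op ⦋q + 1⦌)).obj n,
      (B.map (frontEdge (q + 1)).op).app n ((B.σ i.succ).app n z) =
        (B.map (frontEdge q).op).app n z := fun z => by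
    refine (map_map_app _ _ n z).trans ?_
    rw [frontEdge_comp_σ_succ]
  have d : ∀ z : (B.obj (op ⦋q + 1⦌)).obj n,
      (B.δ 0).app n ((B.σ i.succ).app n z) = (B.σ i).app n ((B.δ 0).app n z) := fun z => by
    refine (map_map_app _ _ n z).trans ?_
    rw [δ_zero_comp_σ_succ]
    exact (map_map_app _ _ n z).symm
  refine (hB n).ext (q + 1) _ _ ?_ ?_
  · refine (frontEdge_extendHomotopy hB H hH (q + 1) n _ t).trans ?_
    refine Eq.trans ?_ (e _).symm
    refine Eq.trans ?_ (frontEdge_extendHomotopy hB H hH q n y t).symm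
    rw [e]
  · refine (δ_zero_extendHomotopy hB H hH (q + 1) n _ t).trans ?_
    refine Eq.trans ?_ (d _).symm
    rw [δ_zero_extendHomotopy hB H hH q n y t, d]

/-- The index `0` is left out because `σ 0` makes the front edge degenerate, and `H` need not keep
degenerate edges degenerate. -/
lemma extendHomotopy_mem (hB : ∀ n, (slice B n).HasFrontDecomposition)
    (H : B.obj (op ⦋1⦌) ⊗ Δ[1] ⟶ B.obj (op ⦋1⦌))
    (hH : ∀ n (e : (B.obj (op ⦋1⦌)).obj n) (t : (Δ[1] : SSet.{w}).obj n),
      (B.δ 0).app n (H.app n (e, t)) = (B.δ 0).app n e)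
    (q : ℕ) (n : SimplexCategoryᵒᵖ)
    (x : (B.obj (op ⦋q + 1⦌)).obj n) (t : (Δ[1] : SSet.{w}).obj n)
    (hx : x ∈ (⨆ i : Fin q, Subcomplex.range (B.σ i.succ)).obj n) :
    (extendHomotopy hB H hH q).app n (x, t) ∈
      (⨆ i : Fin q, Subcomplex.range (B.σ i.succ)).obj n := by
  simp only [Subfunctor.iSup_obj, Set.mem_iUnion] at hx ⊢
  obtain ⟨i, y, rfl⟩ := hx
  cases q with
  | zero => exact i.elim0
  | succ q => exact ⟨i, _, (extendHomotopy_σ_succ hB H hH q i n y t).symm⟩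

/-- The inclusion of the latching subcomplex of `B_{q+1}` is acyclic if the identity of `B_1` and
the map `σ₀ ∘ δ₀` are connected by a zig-zag of homotopies which are constant on targets. -/
lemma isAcyclicPair_latching (hB : ∀ n, (slice B n).HasFrontDecomposition)
    (H : B.obj (op ⦋1⦌) ⊗ Δ[1] ⟶ B.obj (op ⦋1⦌))
    (hH : ∀ n (e : (B.obj (op ⦋1⦌)).obj n) (t : (Δ[1] : SSet.{w}).obj n),
      (B.δ 0).app n (H.app n (e, t)) = (B.δ 0).app n e)
    (H' : B.obj (op ⦋1⦌) ⊗ Δ[1] ⟶ B.obj (op ⦋1⦌))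
    (hH' : ∀ n (e : (B.obj (op ⦋1⦌)).obj n) (t : (Δ[1] : SSet.{w}).obj n),
      (B.δ 0).app n (H'.app n (e, t)) = (B.δ 0).app n e)
    (H_zero : ∀ n (e : (B.obj (op ⦋1⦌)).obj n), H.app n (e, stdSimplex.const 1 0 n) = e)
    (H'_zero : ∀ n (e : (B.obj (op ⦋1⦌)).obj n),
      H'.app n (e, stdSimplex.const 1 0 n) = (B.σ 0).app n ((B.δ 0).app n e))
    (H_one : ∀ n (e : (B.obj (op ⦋1⦌)).obj n),
      H.app n (e, stdSimplex.const 1 1 n) = H'.app n (e, stdSimplex.const 1 1 n)) (q : ℕ) :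
    IsAcyclicPair (⨆ i : Fin (q + 1), Subcomplex.range (B.σ i)) ⊤ := by
  have front_r : ∀ n (x : (B.obj (op ⦋q + 1⦌)).obj n),
      (B.map (frontEdge q).op).app n ((B.σ 0).app n ((B.δ 0).app n x)) =
        (B.σ 0).app n ((B.δ 0).app n ((B.map (frontEdge q).op).app n x)) := by
    intro n x
    refine (congrArg _ (map_map_app _ _ n x)).trans ?_
    refine (map_map_app _ _ n x).trans ?_
    refine Eq.trans ?_ (map_map_app _ _ n _).symm
    refine Eq.trans ?_ (map_map_app _ _ n _).symm
    rw [frontEdge_comp_σ_zero_comp_δ_zero]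
  have δσ : ∀ n (y : (B.obj (op ⦋q⦌)).obj n), (B.δ 0).app n ((B.σ 0).app n y) = y := by
    intro n y
    refine (map_map_app _ _ n y).trans ?_
    rw [show SimplexCategory.δ 0 ≫ SimplexCategory.σ 0 = 𝟙 ⦋q⦌ from
      SimplexCategory.δ_comp_σ_self (i := (0 : Fin (q + 1)))]
    rw [op_id, B.map_id]
    rfl
  have zigzag : ∀ E : (B.obj (op ⦋q + 1⦌)).Subcomplex,
      (∀ n x t, x ∈ E.obj n → (extendHomotopy hB H hH q).app n (x, t) ∈ E.obj n) →
      (∀ n x t, x ∈ E.obj n → (extendHomotopy hB H' hH' q).app n (x, t) ∈ E.obj n) →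
      IsAcyclicPair (Subcomplex.range (B.σ (0 : Fin (q + 1))) ⊓ E) E := by
    intro E hE hE'
    refine IsAcyclicPair.of_zigzag (B.δ 0 ≫ B.σ 0) (extendHomotopy hB H hH q)
      (extendHomotopy hB H' hH' q) ?_ ?_ ?_ hE hE' ?_ ?_
    · intro n x
      refine (hB n).ext q _ _ ((frontEdge_extendHomotopy hB H hH q n x _).trans (H_zero n _))
        (δ_zero_extendHomotopy hB H hH q n x _)
    · intro n x
      refine (hB n).ext q _ _ ((frontEdge_extendHomotopy hB H' hH' q n x _).trans ?_)
        ((δ_zero_extendHomotopy hB H' hH' q n x _).trans ?_)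
      · exact (H'_zero n _).trans (front_r n x).symm
      · exact (δσ n _).symm
    · intro n x
      refine (hB n).ext q _ _ ?_ ?_
      · exact (frontEdge_extendHomotopy hB H hH q n x _).trans
          ((H_one n _).trans (frontEdge_extendHomotopy hB H' hH' q n x _).symm)
      · exact (δ_zero_extendHomotopy hB H hH q n x _).trans
          (δ_zero_extendHomotopy hB H' hH' q n x _).symm
    · intro n x
      exact ⟨(B.δ 0).app n x, rfl⟩
    · rintro n _ ⟨y, rfl⟩
      exact congrArg _ (δσ n y)
  -- The zig-zag is used twice: on all of `B_{q+1}`, and on the part of the latching subcomplex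
  -- coming from positive indices.
  have hD : IsAcyclicPair (Subcomplex.range (B.σ (0 : Fin (q + 1)))) ⊤ := by
    simpa using zigzag ⊤ (fun _ _ _ _ => trivial) (fun _ _ _ _ => trivial)
  have hE := zigzag (⨆ i : Fin q, Subcomplex.range (B.σ i.succ))
    (fun n x t hx => extendHomotopy_mem hB H hH q n x t hx)
    (fun n x t hx => extendHomotopy_mem hB H' hH' q n x t hx)
  have hsup : (⨆ i : Fin (q + 1), Subcomplex.range (B.σ i)) =
      Subcomplex.range (B.σ 0) ⊔ ⨆ i : Fin q, Subcomplex.range (B.σ i.succ) := by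
    refine le_antisymm (iSup_le fun i => ?_)
      (sup_le (le_iSup (fun i => Subcomplex.range (B.σ i)) 0)
        (iSup_le fun i => le_iSup (fun i => Subcomplex.range (B.σ i)) i.succ))
    refine Fin.cases le_sup_left (fun i => ?_) i
    exact (le_iSup (fun i : Fin q => Subcomplex.range (B.σ i.succ)) i).trans le_sup_right
  rw [hsup]
  exact IsAcyclicPair.of_le_of_le le_sup_left le_top hE.excision hD

/-! ### The skeletal filtration of the diagonal. -/

/-- The map `B_q × Δ[q] ⟶ diag B` which is given in degree `n` by the action of the simplicial
operators `⦋n⦌ ⟶ ⦋q⦌`. -/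
def cell (B : SimplicialObject SSet.{w}) (q : ℕ) : B.obj (op ⦋q⦌) ⊗ Δ[q] ⟶ diag B where
  app n := ↾fun z => (B.map (stdSimplex.objEquiv z.2).op).app n z.1
  naturality n m g := by
    ext z
    have h₁ := map_map_app g.unop (stdSimplex.objEquiv z.2) m ((B.obj (op ⦋q⦌)).map g z.1)
    have h₂ := NatTrans.naturality_apply (B.map (stdSimplex.objEquiv z.2).op) g z.1
    have h₃ := NatTrans.naturality_apply (B.map g) g
      ((B.map (stdSimplex.objEquiv z.2).op).app n z.1)
    exact h₁.symm.trans ((congrArg ((B.map g).app m) h₂).trans h₃)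

lemma cell_app_apply (q : ℕ) (n : SimplexCategoryᵒᵖ) (y : (B.obj (op ⦋q⦌)).obj n)
    (t : (Δ[q] : SSet.{w}).obj n) :
    (cell B q).app n (y, t) = (B.map (stdSimplex.objEquiv t).op).app n y := rfl

lemma cell_map (p q : ℕ) (θ : ⦋p⦌ ⟶ ⦋q⦌) (n : SimplexCategoryᵒᵖ) (y : (B.obj (op ⦋q⦌)).obj n)
    (t : n.unop ⟶ ⦋p⦌) :
    (cell B p).app n ((B.map θ.op).app n y, stdSimplex.objEquiv.symm t) =
      (cell B q).app n (y, stdSimplex.objEquiv.symm (t ≫ θ)) := by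
  rw [cell_app_apply, cell_app_apply, Equiv.apply_symm_apply, Equiv.apply_symm_apply]
  exact map_map_app t θ n y

/-- Since `δ 0 ≫ σ 0 = 𝟙`, the pairs `(y, t)` and `(σ₀ y, t ≫ δ 0)` have the same image. -/
lemma range_cell_monotone : Monotone fun q => Subcomplex.range (cell B q) := by
  refine monotone_nat_of_le_succ fun q => ?_
  rintro n _ ⟨⟨y, t⟩, rfl⟩
  refine ⟨((B.map (SimplexCategory.σ (0 : Fin (q + 1))).op).app n y,
    stdSimplex.objEquiv.symm (stdSimplex.objEquiv t ≫ SimplexCategory.δ 0)), ?_⟩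
  refine (cell_map _ _ _ n y _).trans ?_
  rw [Category.assoc, show SimplexCategory.δ 0 ≫ SimplexCategory.σ (0 : Fin (q + 1)) = 𝟙 _ from
    SimplexCategory.δ_comp_σ_self (i := (0 : Fin (q + 1))), Category.comp_id]
  rfl

lemma iSup_range_cell : ⨆ q, Subcomplex.range (cell B q) = ⊤ := by
  refine top_le_iff.1 ?_
  rintro ⟨n⟩ x -
  induction n using SimplexCategory.rec with | _ n
  refine le_iSup (fun q => Subcomplex.range (cell B q)) n _ ?_
  refine ⟨(x, stdSimplex.objEquiv.symm (𝟙 _)), ?_⟩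
  refine (cell_app_apply n _ x _).trans ?_
  rw [Equiv.apply_symm_apply]
  change (B.map (𝟙 _)).app _ x = x
  rw [B.map_id]
  rfl

lemma mem_iSup_range_σ_iff (q : ℕ) (n : SimplexCategoryᵒᵖ) (y : (B.obj (op ⦋q + 1⦌)).obj n) :
    y ∈ (⨆ i : Fin (q + 1), Subcomplex.range (B.σ i)).obj n ↔
      y ∈ (slice B n).degenerate (q + 1) := by
  rw [degenerate_eq_iUnion_range_σ]
  refine Iff.trans ?_ (Set.mem_iUnion (α := (slice B n).obj (op ⦋q + 1⦌))).symm
  simp only [Subfunctor.iSup_obj, Set.mem_iUnion]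
  rfl

/-- If `y` is nondegenerate and `t` is surjective, a section of `t` recovers `y` from the image
simplex, which therefore cannot come from dimension `q`. Otherwise `y` is degenerate or `t` factors
through a face, and the pair can be rewritten in level `q`. -/
lemma cell_mem_range_iff (q : ℕ) (n : SimplexCategoryᵒᵖ)
    (z : (B.obj (op ⦋q + 1⦌) ⊗ Δ[q + 1] : SSet.{w}).obj n) :
    (cell B (q + 1)).app n z ∈ (Subcomplex.range (cell B q)).obj n ↔
      z ∈ ((⨆ i : Fin (q + 1), Subcomplex.range (B.σ i)).unionProd ∂Δ[q + 1]).obj n := by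
  obtain ⟨y, t⟩ := z
  obtain ⟨t, rfl⟩ := stdSimplex.objEquiv.symm.surjective t
  constructor
  · rintro ⟨⟨z, s⟩, h⟩
    by_contra hyt
    have hy : y ∉ (⨆ i : Fin (q + 1), Subcomplex.range (B.σ i)).obj n :=
      fun hy => hyt (Or.inr ⟨hy, trivial⟩)
    have ht : Function.Surjective t.toOrderHom := by
      by_contra ht
      exact hyt (Or.inl ⟨trivial, ht⟩)
    rw [mem_iSup_range_σ_iff] at hy
    have : Epi t := SimplexCategory.epi_iff_surjective.2 ht
    have := isSplitEpi_of_epi t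
    -- Here `skeleton (q + 1)` is generated by the simplices of dimension strictly less than `q +
    -- 1`.
    have hz : z ∈ ((slice B n).skeleton (q + 1)).obj (op ⦋q⦌) := mem_skeleton _ _ (by omega)
    have hx := ((slice B n).skeleton (q + 1)).map (section_ t).op
      (((slice B n).skeleton (q + 1)).map (stdSimplex.objEquiv s).op hz)
    have hy' : (slice B n).map (section_ t).op
        ((slice B n).map (stdSimplex.objEquiv s).op z) = y := by
      refine (congrArg _ h).trans ?_
      refine (map_map_app (section_ t) t n y).trans ?_
      rw [IsSplitEpi.id, op_id, B.map_id]
      rfl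
    have hx' : y ∈ ((slice B n).skeleton (q + 1)).obj (op ⦋q + 1⦌) := hy' ▸ hx
    exact absurd ((mem_skeleton_obj_iff_of_nonDegenerate (slice B n) ⟨y, hy⟩ (q + 1)).1 hx')
      (lt_irrefl _)
  · rintro (⟨-, ht⟩ | ⟨hy, -⟩)
    · obtain ⟨i, θ, rfl⟩ := SimplexCategory.eq_comp_δ_of_not_surjective t ht
      exact ⟨_, cell_map q (q + 1) (SimplexCategory.δ i) n y θ⟩
    · simp only [Subfunctor.iSup_obj, Set.mem_iUnion] at hy
      obtain ⟨i, z, rfl⟩ := hy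
      exact ⟨_, (cell_map (q + 1) q (SimplexCategory.σ i) n z t).symm⟩

/-- This is the uniqueness in the Eilenberg–Zilber lemma, applied to the slice in degree `n`. -/
lemma cell_injOn (q : ℕ) (n : SimplexCategoryᵒᵖ)
    (z z' : (B.obj (op ⦋q + 1⦌) ⊗ Δ[q + 1] : SSet.{w}).obj n)
    (hz : (cell B (q + 1)).app n z ∉ (Subcomplex.range (cell B q)).obj n)
    (h : (cell B (q + 1)).app n z = (cell B (q + 1)).app n z') : z = z' := by
  have hz' := hz
  rw [h, cell_mem_range_iff] at hz'
  rw [cell_mem_range_iff] at hz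
  obtain ⟨y, t⟩ := z
  obtain ⟨y', t'⟩ := z'
  obtain ⟨t, rfl⟩ := stdSimplex.objEquiv.symm.surjective t
  obtain ⟨t', rfl⟩ := stdSimplex.objEquiv.symm.surjective t'
  have hy : y ∈ (slice B n).nonDegenerate (q + 1) := fun hy =>
    hz (Or.inr ⟨(mem_iSup_range_σ_iff q n y).2 hy, trivial⟩)
  have hy' : y' ∈ (slice B n).nonDegenerate (q + 1) := fun hy =>
    hz' (Or.inr ⟨(mem_iSup_range_σ_iff q n y').2 hy, trivial⟩)
  have ht : Function.Surjective t.toOrderHom := by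
    by_contra ht
    exact hz (Or.inl ⟨trivial, ht⟩)
  have : Epi t := SimplexCategory.epi_iff_surjective.2 ht
  obtain ⟨n⟩ := n
  induction n using SimplexCategory.rec with | _ n
  have e₁ := unique_nonDegenerate_simplex (slice B (op ⦋n⦌)) _ t ⟨y, hy⟩ rfl t' ⟨y', hy'⟩ h
  have e₂ := unique_nonDegenerate_map (slice B (op ⦋n⦌)) _ t ⟨y, hy⟩ rfl t' ⟨y', hy'⟩ h
  obtain rfl : y = y' := congrArg Subtype.val e₁
  rw [e₂]

/-- If the latching maps of `B` are acyclic, then so is the inclusion of `B_0` in the diagonal. -/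
lemma isAcyclicPair_diag
    (hB : ∀ q : ℕ, IsAcyclicPair (⨆ i : Fin (q + 1), Subcomplex.range (B.σ i)) ⊤) :
    IsAcyclicPair (Subcomplex.range (cell B 0)) ⊤ := by
  rw [← iSup_range_cell]
  refine IsAcyclicPair.of_sequence range_cell_monotone fun q => ?_
  have := ((hB q).unionProd ∂Δ[q + 1]).of_map (cell B (q + 1)) (cell_mem_range_iff q)
    (cell_injOn q)
  rwa [sup_eq_right.2 (range_cell_monotone (B := B) (Nat.le_succ q))] at this

/-! ### Front decompositions of nerves. -/

lemma HasFrontDecomposition.of_bijective {X Y : SSet.{w}} (hY : Y.HasFrontDecomposition)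
    (t : ∀ q : ℕ, X.obj (op ⦋q⦌) → Y.obj (op ⦋q⦌)) (ht : ∀ q, Function.Bijective (t q))
    (ht' : ∀ (p q : ℕ) (θ : ⦋p⦌ ⟶ ⦋q⦌) (x : X.obj (op ⦋q⦌)),
      t p (X.map θ.op x) = Y.map θ.op (t q x)) : X.HasFrontDecomposition where
  ext q x y h h' := by
    refine (ht _).1 (hY.ext q _ _ ?_ ?_)
    · rw [← ht', ← ht', h]
    · exact (ht' _ _ (SimplexCategory.δ 0) x).symm.trans
        ((congrArg (t q) h').trans (ht' _ _ (SimplexCategory.δ 0) y))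
  exists_glue q e y h := by
    obtain ⟨z, hz, hz'⟩ := hY.exists_glue q (t 1 e) (t q y)
      ((ht' _ _ (SimplexCategory.δ 0) e).symm.trans ((congrArg (t 0) h).trans (ht' _ _ _ y)))
    obtain ⟨x, rfl⟩ := (ht _).2 z
    exact ⟨x, (ht _).1 ((ht' _ _ _ x).trans hz),
      (ht _).1 ((ht' _ _ (SimplexCategory.δ 0) x).trans hz')⟩

lemma hasFrontDecomposition_nerve (V : Type u') [Category.{v'} V] :
    (nerve V).HasFrontDecomposition where
  ext q x y h h' := by
    have h₀ : x.obj 0 = y.obj 0 := congrArg (fun z : ComposableArrows V 1 => z.obj 0) h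
    refine ComposableArrows.ext_succ h₀ h' ?_
    have key : ∀ z z' : ComposableArrows V 1, z = z' →
        ∀ (h₀ : z.obj 0 = z'.obj 0) (h₁ : z.obj 1 = z'.obj 1),
        z.map' 0 1 = eqToHom h₀ ≫ z'.map' 0 1 ≫ eqToHom h₁.symm := by
      rintro z _ rfl h₀ h₁
      simp
    exact key _ _ h _ (congrArg (fun z : ComposableArrows V 1 => z.obj 1) h)
  exists_glue q e y h := by
    obtain ⟨a, b, f, rfl⟩ := ComposableArrows.mk₁_surjective e
    obtain rfl : b = y.obj 0 := congrArg (fun z : ComposableArrows V 0 => z.obj 0) h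
    refine ⟨ComposableArrows.precomp y f, ?_, ?_⟩
    · exact ComposableArrows.ext₁ rfl rfl ((Category.id_comp _).trans (Category.comp_id f)).symm
    · rfl

end SSet

/-! ### Slices of the bisimplicial nerve as nerves of categories of `v`-transformations. -/

namespace DoubleCategory

/-- A diagram of `h`-maps of shape `J`. -/
structure HDiagram (J : Type w) [Category.{v'} J] (C : DoubleCategory.{v, u}) where
  /-- the underlying functor -/
  functor : J ⥤ C.H

namespace HDiagram

variable {J : Type} [Category.{0} J] {C : DoubleCategory.{v, u}}

/-- A `v`-transformation of diagrams of `h`-maps: it gives bicommutative squares. -/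
@[ext]
structure Hom (F G : HDiagram J C) where
  /-- the components -/
  app : ∀ j, C.vCat.Hom (F.functor.obj j) (G.functor.obj j)
  sq : ∀ {i j : J} (f : i ⟶ j), C.Sq (F.functor.map f) (app i) (app j) (G.functor.map f)

instance : Category.{v} (HDiagram J C) where
  Hom := Hom
  id _ := ⟨fun _ => C.vCat.id _, fun _ => C.sq_vId _⟩
  comp s t := ⟨fun j => C.vCat.comp (s.app j) (t.app j), fun f => C.sq_vComp (s.sq f) (t.sq f)⟩
  id_comp _ := Hom.ext (funext fun _ => C.vCat.id_comp _)
  comp_id _ := Hom.ext (funext fun _ => C.vCat.comp_id _)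
  assoc _ _ _ := Hom.ext (funext fun _ => C.vCat.assoc _ _ _)

end HDiagram

section

variable {J : Type} [Category.{0} J] {C : DoubleCategory.{v, u}}

/-- All `h`-maps of `Δ^q_v` are identities, so the action on them is forced. -/
lemma DFunctor.ext_deltaV {q : ℕ} {F G : DFunctor (deltaV q) C} (h : ∀ k, F.obj k = G.obj k)
    (h' : ∀ (k l : Fin (q + 1)) (a : (deltaV q).vCat.Hom k l), HEq (F.vmap a) (G.vmap a)) :
    F = G := by
  have hF : ∀ (F : DFunctor (deltaV q) C) (k l : Fin (q + 1)) (e : (deltaV q).hCat.Hom k l),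
      HEq (F.hmap e) (C.hCat.id (F.obj k)) := by
    rintro F k l ⟨⟨e⟩⟩
    obtain rfl : k = l := e
    exact heq_of_eq (F.hmap_id k)
  obtain ⟨o, hm, vm, a₁, a₂, a₃, a₄, a₅⟩ := F
  obtain ⟨o', hm', vm', b₁, b₂, b₃, b₄, b₅⟩ := G
  obtain rfl : o = o' := funext h
  have e₁ : @hm = @hm' := by
    funext k l e
    exact eq_of_heq ((hF ⟨o, hm, vm, a₁, a₂, a₃, a₄, a₅⟩ k l e).trans
      (hF ⟨o, hm', vm', b₁, b₂, b₃, b₄, b₅⟩ k l e).symm)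
  have e₂ : @vm = @vm' := by
    funext k l a
    exact eq_of_heq (h' k l a)
  subst e₁ e₂
  rfl

lemma HTrans.hext {q : ℕ} {F G F' G' : DFunctor (deltaV q) C} (hF : F = F') (hG : G = G')
    (s : HTrans F G) (s' : HTrans F' G') (h : ∀ k, HEq (s.app k) (s'.app k)) : HEq s s' := by
  subst hF hG
  exact heq_of_eq (HTrans.ext (funext fun k => eq_of_heq (h k)))

/-- A diagram of `h`-maps in `Map(Δ^q_v, C)`, seen as a chain of `q` transformations of diagrams of
`h`-maps in `C`. -/
def transpose {q : ℕ} (x : J ⥤ (Map (deltaV q) C).H) : Fin (q + 1) ⥤ HDiagram J C where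
  obj k := ⟨x ⋙ evalH (I := deltaV q) k C⟩
  map {k l} a :=
    { app := fun j => DFunctor.vmap (I := deltaV q) (x.obj j) (X := k) (Y := l) ⟨⟨leOfHom a⟩⟩
      sq := fun f => HTrans.sq (I := deltaV q) (x.map f) (X := k) (Y := l) ⟨⟨leOfHom a⟩⟩ }
  map_id k := HDiagram.Hom.ext (funext fun j => DFunctor.vmap_id (I := deltaV q) (x.obj j) k)
  map_comp _ _ := HDiagram.Hom.ext (funext fun j => DFunctor.vmap_comp (I := deltaV q) (x.obj j) _ _)

/-- The inverse of `transpose` on objects. -/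
def untransposeObj {q : ℕ} (y : Fin (q + 1) ⥤ HDiagram J C) (j : J) : DFunctor (deltaV q) C where
  obj k := (y.obj k).functor.obj j
  hmap {k l} e := eqToHom (C := C.H) (congrArg (fun k => (y.obj k).functor.obj j) e.down.down)
  vmap {k l} a := HDiagram.Hom.app (y.map (homOfLE a.down.down)) j
  hmap_id _ := rfl
  hmap_comp _ _ := (eqToHom_trans (C := C.H) _ _).symm
  vmap_id k := congrArg (fun s => HDiagram.Hom.app s j) (y.map_id k)
  vmap_comp {k l m} a b := congrArg (fun s => HDiagram.Hom.app s j)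
    (y.map_comp (homOfLE a.down.down) (homOfLE b.down.down))
  map_sq {k l k' l' e a b e'} _ := by
    obtain ⟨⟨e⟩⟩ := e
    obtain ⟨⟨e'⟩⟩ := e'
    obtain rfl : k = l := e
    obtain rfl : k' = l' := e'
    exact C.sq_hId _

/-- The inverse of `transpose`. -/
def untranspose {q : ℕ} (y : Fin (q + 1) ⥤ HDiagram J C) : J ⥤ (Map (deltaV q) C).H where
  obj j := untransposeObj y j
  map {i j} f :=
    { app := fun k => (y.obj k).functor.map f
      naturality := by
        rintro k l ⟨⟨e⟩⟩
        obtain rfl : k = l := e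
        exact (C.hCat.id_comp _).trans (C.hCat.comp_id _).symm
      sq := fun a => HDiagram.Hom.sq (y.map (homOfLE a.down.down)) f :
        HTrans (untransposeObj y i) (untransposeObj y j) }
  map_id j := HTrans.ext (funext fun k => (y.obj k).functor.map_id j)
  map_comp f g := HTrans.ext (funext fun k => (y.obj k).functor.map_comp f g)

lemma transpose_untranspose {q : ℕ} (y : Fin (q + 1) ⥤ HDiagram J C) :
    transpose (untranspose y) = y := rfl

lemma functor_ext_of_eval {q : ℕ} {x x' : J ⥤ (Map (deltaV q) C).H}
    (h : ∀ k : Fin (q + 1), x ⋙ evalH (I := deltaV q) k C = x' ⋙ evalH (I := deltaV q) k C)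
    (h' : ∀ (j : J) (k l : Fin (q + 1)) (a : (deltaV q).vCat.Hom k l),
      HEq (DFunctor.vmap (I := deltaV q) (x.obj j) a)
        (DFunctor.vmap (I := deltaV q) (x'.obj j) a)) : x = x' := by
  have hobj : ∀ j, x.obj j = x'.obj j := fun j =>
    DFunctor.ext_deltaV (fun k => congrArg (fun F : J ⥤ C.H => F.obj j) (h k)) (h' j)
  refine Functor.hext hobj fun i j f => ?_
  refine HTrans.hext (hobj i) (hobj j) _ _ fun k => ?_
  have key : ∀ F F' : J ⥤ C.H, F = F' → HEq (F.map f) (F'.map f) := by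
    rintro F _ rfl
    rfl
  exact key _ _ (h k)

lemma transpose_injective {q : ℕ} :
    Function.Injective (transpose : (J ⥤ (Map (deltaV q) C).H) → _) := by
  intro x x' h
  refine functor_ext_of_eval
    (fun k => congrArg (fun T : Fin (q + 1) ⥤ HDiagram J C => (T.obj k).functor) h)
    fun j k l a => ?_
  have key : ∀ T T' : Fin (q + 1) ⥤ HDiagram J C, T = T' →
      HEq (HDiagram.Hom.app (T.map (homOfLE a.down.down)) j)
        (HDiagram.Hom.app (T'.map (homOfLE a.down.down)) j) := by
    rintro T _ rfl
    rfl
  exact key _ _ h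

/-- The only `v`-map of `Δ^0_v` is an identity, so `Map(Δ^0_v, C)_h` is `C_h` by evaluation. -/
lemma functor_ext_deltaV_zero {x x' : J ⥤ (Map (deltaV 0) C).H}
    (h : x ⋙ evalH (I := deltaV 0) (0 : Fin 1) C = x' ⋙ evalH (I := deltaV 0) (0 : Fin 1) C) :
    x = x' := by
  have h₀ : ∀ k : Fin 1, x ⋙ evalH (I := deltaV 0) k C = x' ⋙ evalH (I := deltaV 0) k C := by
    intro k
    obtain rfl := Subsingleton.elim k 0
    exact h
  refine functor_ext_of_eval h₀ fun j k l a => ?_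
  obtain rfl : k = l := Subsingleton.elim (α := Fin 1) k l
  have key : ∀ (F : DFunctor (deltaV 0) C), F.vmap a = C.vCat.id (F.obj k) := fun F => F.vmap_id k
  refine (heq_of_eq (key (x.obj j))).trans (HEq.trans ?_ (heq_of_eq (key (x'.obj j))).symm)
  exact congr_arg_heq (fun X => C.vCat.id X) (congrArg (fun F : J ⥤ C.H => F.obj j) (h₀ k))

end

/-- Transposition identifies the slice with the nerve of the category of chains of `n` `h`-maps and
`v`-transformations between them. -/
lemma hasFrontDecomposition_slice (C : DoubleCategory.{v, u}) (n : SimplexCategoryᵒᵖ) :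
    (SSet.slice C.bisimplicialNerve n).HasFrontDecomposition := by
  refine (SSet.hasFrontDecomposition_nerve (HDiagram (Fin (n.unop.len + 1)) C)).of_bijective
    (fun q => transpose) (fun q => ⟨transpose_injective, fun y => ⟨untranspose y, transpose_untranspose y⟩⟩) ?_
  intro p q θ x
  rfl

/-! ### The homotopies given by the columns of the zig-zag. -/

section

variable {C : DoubleCategory.{v, u}} (c : Fin 2 → Fin 3)
  (hc : ∀ k l : Fin 2, k ≤ l → zigzagRel (c k) (c l))

/-- Restriction to the columns `c 0` and `c 1` of `Z`, which are connected by `h`-maps. -/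
def columnsH : (Map zigzagSquares C).H × Fin 2 ⥤ (Map (deltaV 1) C).H where
  obj p := DFunctor.comp (column (c p.2)) p.1
  map {p p'} s :=
    { app := fun j => C.hCat.comp (HTrans.app s.1 (c p.2, j))
        (DFunctor.hmap p'.1 (X := (c p.2, j)) (Y := (c p'.2, j))
          ⟨⟨hc _ _ (leOfHom s.2), rfl⟩⟩)
      naturality := by
        rintro k l ⟨⟨e⟩⟩
        obtain rfl : k = l := e
        have h := DFunctor.hmap_id p.1 (c p.2, k)
        have h' := DFunctor.hmap_id p'.1 (c p'.2, k)
        refine (congrArg (fun a => C.hCat.comp a _) h).trans ?_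
        refine (C.hCat.id_comp _).trans ?_
        refine Eq.trans (C.hCat.comp_id _).symm ?_
        exact congrArg _ h'.symm
      sq := fun a => C.sq_hComp (HTrans.sq s.1 _) (DFunctor.map_sq p'.1 trivial) :
        HTrans (DFunctor.comp (column (c p.2)) p.1) (DFunctor.comp (column (c p'.2)) p'.1) }
  map_id p := HTrans.ext (funext fun j =>
    (congrArg _ (DFunctor.hmap_id p.1 (c p.2, j))).trans (C.hCat.id_comp _))
  map_comp {p p' p''} s t := HTrans.ext (funext fun j => by
    have h := HTrans.naturality t.1 (X := (c p.2, j)) (Y := (c p'.2, j))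
      ⟨⟨hc _ _ (leOfHom s.2), rfl⟩⟩
    have h' := DFunctor.hmap_comp p''.1 (X := (c p.2, j)) (Y := (c p'.2, j)) (Z := (c p''.2, j))
      ⟨⟨hc _ _ (leOfHom s.2), rfl⟩⟩ ⟨⟨hc _ _ (leOfHom t.2), rfl⟩⟩
    refine (congrArg (C.hCat.comp (C.hCat.comp (HTrans.app s.1 (c p.2, j))
      (HTrans.app t.1 (c p.2, j)))) h').trans ?_
    refine (C.hCat.assoc _ _ _).trans (Eq.trans ?_ (C.hCat.assoc _ _ _).symm)
    refine congrArg (C.hCat.comp (HTrans.app s.1 (c p.2, j))) ?_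
    refine (C.hCat.assoc _ _ _).symm.trans (Eq.trans ?_ (C.hCat.assoc _ _ _))
    exact congrArg (fun a => C.hCat.comp a _) h.symm)

/-- Evaluation at the objects `c 0` and `c 1` of a zig-zag of `h`-maps. -/
def pointsH : (Map zigzagH C).H × Fin 2 ⥤ C.H where
  obj p := DFunctor.obj p.1 (c p.2)
  map {p p'} s := C.hCat.comp (HTrans.app s.1 (c p.2))
    (DFunctor.hmap p'.1 (X := c p.2) (Y := c p'.2) ⟨⟨hc _ _ (leOfHom s.2)⟩⟩)
  map_id p := (congrArg _ (DFunctor.hmap_id p.1 (c p.2))).trans (C.hCat.id_comp _)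
  map_comp {p p' p''} s t := by
    have h := HTrans.naturality t.1 (X := c p.2) (Y := c p'.2) ⟨⟨hc _ _ (leOfHom s.2)⟩⟩
    have h' := DFunctor.hmap_comp p''.1 (X := c p.2) (Y := c p'.2) (Z := c p''.2)
      ⟨⟨hc _ _ (leOfHom s.2)⟩⟩ ⟨⟨hc _ _ (leOfHom t.2)⟩⟩
    refine (congrArg (C.hCat.comp (C.hCat.comp (HTrans.app s.1 (c p.2))
      (HTrans.app t.1 (c p.2)))) h').trans ?_
    refine (C.hCat.assoc _ _ _).trans (Eq.trans ?_ (C.hCat.assoc _ _ _).symm)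
    refine congrArg (C.hCat.comp (HTrans.app s.1 (c p.2))) ?_
    refine (C.hCat.assoc _ _ _).symm.trans (Eq.trans ?_ (C.hCat.assoc _ _ _))
    exact congrArg (fun a => C.hCat.comp a _) h.symm

variable {J : Type} [Category.{0} J]

lemma prod'_const_comp_columnsH (x : J ⥤ (Map zigzagSquares C).H) (k : Fin 2) :
    x.prod' ((Functor.const J).obj k) ⋙ columnsH c hc = x ⋙ restrictH (column (c k)) C := by
  refine Functor.hext (fun _ => rfl) fun i j f => heq_of_eq (HTrans.ext (funext fun l => ?_))
  exact (congrArg _ (DFunctor.hmap_id (x.obj j) (c k, l))).trans (C.hCat.comp_id _)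

/-- Along a constant row `Y = Y = Y` the position `t` does not matter: this is the constancy of the
homotopies on targets. -/
lemma prod'_constH_comp_pointsH (x : J ⥤ C.H) (t : J ⥤ Fin 2) :
    (x ⋙ constH zigzagH C).prod' t ⋙ pointsH c hc = x :=
  Functor.hext (fun _ => rfl) fun _ _ _ => heq_of_eq (C.hCat.comp_id _)

variable (Φ : (Map (deltaV 1) C).H ⥤ (Map zigzagSquares C).H)

/-- The homotopy between the restrictions of `Φ` to the columns `c 0` and `c 1` of `Z`. -/
def columnsHomotopy : C.bisimplicialNerve.obj (op ⦋1⦌) ⊗ Δ[1] ⟶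
    C.bisimplicialNerve.obj (op ⦋1⦌) where
  app n := ↾fun z => (Functor.prod' (A := Fin (n.unop.len + 1)) (z.1 ⋙ Φ)
    (SSet.stdSimplex.asOrderHom z.2).monotone.functor) ⋙ columnsH c hc
  naturality _ _ _ := rfl

lemma columnsHomotopy_const (k : Fin 2) (n : SimplexCategoryᵒᵖ)
    (e : (C.bisimplicialNerve.obj (op ⦋1⦌)).obj n) :
    (columnsHomotopy c hc Φ).app n (e, SSet.stdSimplex.const 1 k n) =
      Functor.comp (C := Fin (n.unop.len + 1)) e (Φ ⋙ restrictH (column (c k)) C) :=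
  prod'_const_comp_columnsH (J := Fin (n.unop.len + 1)) c hc (e ⋙ Φ) k

/-- The targets of the columns of `Z` form its bottom row, on which `Φ` is constant, on morphisms as
well as on objects. -/
lemma δ_zero_columnsHomotopy
    (hΦ : Φ ⋙ restrictH bottomRow C = targetH C ⋙ constH zigzagH C) (n : SimplexCategoryᵒᵖ)
    (e : (C.bisimplicialNerve.obj (op ⦋1⦌)).obj n) (t : (Δ[1] : SSet.{max u v}).obj n) :
    (C.bisimplicialNerve.δ 0).app n ((columnsHomotopy c hc Φ).app n (e, t)) =
      (C.bisimplicialNerve.δ 0).app n e := by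
  refine functor_ext_deltaV_zero (J := Fin (n.unop.len + 1)) ?_
  let τ : Fin (n.unop.len + 1) ⥤ Fin 2 := (SSet.stdSimplex.asOrderHom t).monotone.functor
  let x : Fin (n.unop.len + 1) ⥤ (Map (deltaV 1) C).H := e
  have h := congrArg (fun F : (Map (deltaV 1) C).H ⥤ (Map zigzagH C).H =>
    (x ⋙ F).prod' τ ⋙ pointsH c hc) hΦ
  exact Eq.trans h (prod'_constH_comp_pointsH c hc (x ⋙ targetH C) τ)

end

/-! ### The image of `N C_h` in the diagonal. -/

variable (C : DoubleCategory.{v, u})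

lemma range_nerveToDiag :
    SSet.Subcomplex.range C.nerveToDiag =
      SSet.Subcomplex.range (SSet.cell C.bisimplicialNerve 0) := by
  ext n x
  constructor
  · rintro ⟨x, rfl⟩
    exact ⟨(Functor.comp (C := Fin (n.unop.len + 1)) x (constH (deltaV 0) C),
      SSet.stdSimplex.const 0 0 n), rfl⟩
  · rintro ⟨⟨y, t⟩, rfl⟩
    let y' : Fin (n.unop.len + 1) ⥤ (Map (deltaV 0) C).H := y
    obtain ⟨x, hx⟩ : ∃ x : Fin (n.unop.len + 1) ⥤ C.H, y' = x ⋙ constH (deltaV 0) C :=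
      ⟨y' ⋙ evalH (I := deltaV 0) (0 : Fin 1) C, functor_ext_deltaV_zero rfl⟩
    obtain rfl : y = _ := hx
    exact ⟨x, rfl⟩

lemma nerveToDiag_app_injective (n : SimplexCategoryᵒᵖ) :
    Function.Injective (C.nerveToDiag.app n) := fun _ _ h =>
  congrArg (fun F : Fin (n.unop.len + 1) ⥤ (Map (deltaV n.unop.len) C).H =>
    F ⋙ evalH (I := deltaV n.unop.len) (0 : Fin (n.unop.len + 1)) C) h

end DoubleCategory

end

theorem proposition3p2 (C : DoubleCategory.{v, u})
    (hC : ∃ Φ : (DoubleCategory.Map (DoubleCategory.deltaV 1) C).H ⥤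
        (DoubleCategory.Map DoubleCategory.zigzagSquares C).H,
      DoubleCategory.IsReductionZigZag C Φ) :
    SSet.IsWeakEquivalence C.nerveToDiag := by
  obtain ⟨Φ, hΦ⟩ := hC
  -- Both homotopies run from an outer column of `Z` (left for `![0, 1]`, right for `![2, 1]`) to
  -- the middle one, so they share their end at `1`.
  have hc₀ : ∀ k l : Fin 2, k ≤ l → DoubleCategory.zigzagRel (![0, 1] k) (![0, 1] l) := by
    unfold DoubleCategory.zigzagRel
    decide
  have hc₁ : ∀ k l : Fin 2, k ≤ l → DoubleCategory.zigzagRel (![2, 1] k) (![2, 1] l) := by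
    unfold DoubleCategory.zigzagRel
    decide
  have latching := SSet.isAcyclicPair_latching
    C.hasFrontDecomposition_slice
    (DoubleCategory.columnsHomotopy ![0, 1] hc₀ Φ)
    (DoubleCategory.δ_zero_columnsHomotopy ![0, 1] hc₀ Φ hΦ.bottom_row)
    (DoubleCategory.columnsHomotopy ![2, 1] hc₁ Φ)
    (DoubleCategory.δ_zero_columnsHomotopy ![2, 1] hc₁ Φ hΦ.bottom_row)
    (fun n e => (DoubleCategory.columnsHomotopy_const _ hc₀ Φ 0 n e).trans
      (congrArg (Functor.comp (C := Fin (n.unop.len + 1)) e) hΦ.left_column))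
    (fun n e => by
      refine (DoubleCategory.columnsHomotopy_const _ hc₁ Φ 0 n e).trans
        ((congrArg (Functor.comp (C := Fin (n.unop.len + 1)) e) hΦ.right_column).trans ?_)
      -- The face `δ 0` takes targets, so applying `σ 0` to it gives the identity `v`-maps of the
      -- right column.
      have h : (C.bisimplicialNerve.δ 0).app n e = Functor.comp (C := Fin (n.unop.len + 1)) e
          (DoubleCategory.targetH C ⋙ DoubleCategory.constH (DoubleCategory.deltaV 0) C) :=
        DoubleCategory.functor_ext_deltaV_zero (J := Fin (n.unop.len + 1)) rfl
      rw [h]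
      rfl)
    (fun n e => (DoubleCategory.columnsHomotopy_const _ hc₀ Φ 1 n e).trans
      (DoubleCategory.columnsHomotopy_const _ hc₁ Φ 1 n e).symm)
  have := SSet.isAcyclicPair_diag latching
  rw [← DoubleCategory.range_nerveToDiag] at this
  exact this.isWeakEquivalence C.nerveToDiag_app_injective fun n x =>
    ⟨Functor.comp (C := Fin (n.unop.len + 1)) x
      (DoubleCategory.evalH (I := DoubleCategory.deltaV n.unop.len)
        (0 : Fin (n.unop.len + 1)) C)⟩
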